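/- **Setting.** Let $d\ge 1$, $s\in\mathbb N$, $\mu,L>0$, $R=\frac{L}{2\mu}$, $e_0=\frac{L^2}{8\mu}$, $r_f\in[0,1)$, $\epsilon>0$, $\delta\in(0,1)$ and $\kappa=\epsilon^{-1}\sqrt{2\ln(1.25/\delta)}$. Let $\mathcal D_r$ (retain) and $\mathcal D_f$ (forget) be probability distributions on $\mathbb R^s$, and $\mathcal D=r_f\mathcal D_f+(1-r_f)\mathcal D_r$. Assume that for every $p\in[0,1]$ there is a measurable $A\subset\mathbb R^s$ with $\mathcal D_r(A)=p$. *Losses.* $\mathcal F_{sc}$ is the class of measurable functions $\ell:\mathbb R^d\times\mathbb R^s\to\mathbb R$, differentiable in $\theta\in\mathbb R^d$, such that for every $\xi$ the function $\ell(\cdot,\xi)$ is $L$-Lipschitz and $\mu$-strongly convex on the closed ball $B(0,R)$. For a distribution $\mathcal P$ on $\mathbb R^s$, the risk is $\theta\mapsto\mathbb E_{\xi\sim\mathcal P}[\ell(\theta,\xi)]$; let $\mathcal L_r$ be the risk for $\mathcal D_r$. Let $\theta^*$ and $\theta_r^*$ be the unique minimizers over $\mathbb R^d$ of the risks for $\mathcal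 D$ and $\mathcal D_r$. Wherever a minimizer is mentioned, only losses are considered for which the risk is finite on $\mathbb R^d$ and the unique minimizer exists and lies in $B(0,R)$. *Algorithms.* A randomized iterative first-order algorithm turns an initial model $\theta_0$ and a random seed into a first query point and a memory state; at each iteration it draws a fresh sample $\xi\sim\mathcal D_r$ and updates model and memory as a measurable function of the current model $\theta$, the gradient $\nabla_\theta\ell(\theta,\xi)$, the memory and the seed; after $T$ iterations it outputs a measurable function of model and memory. It is a learning algorithm when started at $\theta_0=0$, and an unlearning algorithm when started at $\theta_0=\theta^*$. For fixed $r_f,\mu,L$, an algorithm achieves $(\epsilon,\delta)$-unlearning if for all $T$, all $\ell\in\mathcal F_{sc}$, all probability distributions $\mathcal D_r,\mathcal D_f,\mathcal D_f'$ on $\mathbb R^s$ and all measurable $S\subset\mathbb R^d$, its outputs $\mathcal U(\mathcal D_r,\mathcal D_f)$ and $\mathcal U(\mathcal D_r,\mathcal D_f')$ after $T$ iterations on samples of $\mathcal D_r$, started at the risk minimizers for $r_f\mathcal D_f+(1-r_f)\mathcal D_r$ and $r_f\mathcal D_f'+(1-r_f)\mathcal D_r$ respectively, satisfy $\mathbb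 P[\mathcal U(\mathcal D_r,\mathcal D_f)\in S]\le e^{\epsilon}\,\mathbb P[\mathcal U(\mathcal D_r,\mathcal D_f')\in S]+\delta$. *Times.* For a target excess risk $e$, the time of an algorithm on $\ell$ is the smallest number $T$ of iterations such that after any number $T'\ge T$ of iterations the output $\hat\theta$ satisfies $\mathbb E[\mathcal L_r(\hat\theta)-\mathcal L_r(\theta_r^*)]\le e$ ($\infty$ if there is none). $T^S_e$ is the infimum over learning algorithms of the supremum over $\ell\in\mathcal F_{sc}$ of this time, and $T^U_e$ is the infimum over algorithms achieving $(\epsilon,\delta)$-unlearning of the supremum over $\ell\in\mathcal F_{sc}$ of the time when started at $\theta^*$. **Theorem (Noise and Fine-Tune Efficiency).** For every $\bar\epsilon>0$ there are constants $c,C>0$, depending only on $\bar\epsilon$, such that in the above setting with $\epsilon\le\bar\epsilon$, for every $0<e<e_0$, we have $0<T^S_e<\infty$ and $$\frac{T^U_e}{T^S_e}\le C\left(\frac{r_f}{1-r_f}\right)^2\left(1+d\kappa^2\right)\frac{e_0}{e}.$$ Moreover, the bound is achieved by "noise and fine-tune": the algorithm that adds to $\theta^*$ a Gaussian noise of law $\mathcal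 N(0,\sigma^2I_d)$ with $\sigma=c\,\kappa\,\frac{r_f}{1-r_f}\frac{L}{\mu}$, then runs stochastic gradient descent on $\mathcal D_r$ with step size $e/L^2$, projected onto $B(0,R)$ (the noisy initial point included), and returns the average of the iterates, achieves $(\epsilon,\delta)$-unlearning, and the supremum over $\ell\in\mathcal F_{sc}$ of its time, divided by $T^S_e$, satisfies the same bound. -/

import Mathlib

open MeasureTheory ProbabilityTheory
open scoped ENNReal

namespace Unlearning

/-- `ℝᵈ` with its Euclidean norm. -/
abbrev E (d : ℕ) : Type := EuclideanSpace ℝ (Fin d)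

/-! ### Losses and risks -/

/-- The class `F_sc(μ, L)` of losses `ℓ : ℝᵈ × ℝˢ → ℝ`: `ℓ` is measurable, differentiable in the
parameter, and for every data point `L`-Lipschitz and `μ`-strongly convex on the closed ball
`B(0, R)` of radius `R = L / (2 μ)`. -/
structure IsSCLoss {d s : ℕ} (μ L : ℝ) (l : E d → E s → ℝ) : Prop where
  measurable : Measurable (Function.uncurry l)
  differentiable : ∀ ξ, Differentiable ℝ (fun θ => l θ ξ)
  lipschitz : ∀ ξ θ θ', ‖θ‖ ≤ L / (2 * μ) → ‖θ'‖ ≤ L / (2 * μ) →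
    |l θ ξ - l θ' ξ| ≤ L * ‖θ - θ'‖
  strongly_convex : ∀ ξ θ θ', ‖θ‖ ≤ L / (2 * μ) → ‖θ'‖ ≤ L / (2 * μ) →
    l θ ξ + inner ℝ (gradient (fun η => l η ξ) θ) (θ' - θ) + μ / 2 * ‖θ' - θ‖ ^ 2 ≤ l θ' ξ

/-- The risk `𝔼_{ξ ∼ D} ℓ(θ, ξ)`. -/
noncomputable def risk {d s : ℕ} (l : E d → E s → ℝ) (D : Measure (E s)) (θ : E d) : ℝ :=
  ∫ ξ, l θ ξ ∂D

/-- The risk of `ℓ` under `D` is well defined on `ℝᵈ`, and `θ` is its unique minimizer over `ℝᵈ`;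
it lies in the ball `B(0, R)` on which the losses are controlled. -/
structure IsRiskMinimizer {d s : ℕ} (R : ℝ) (l : E d → E s → ℝ) (D : Measure (E s))
    (θ : E d) : Prop where
  integrable : ∀ θ', Integrable (l θ') D
  norm_le : ‖θ‖ ≤ R
  lt : ∀ θ', θ' ≠ θ → risk l D θ < risk l D θ'

/-- The full data distribution `r_f D_f + (1 - r_f) D_r`. -/
noncomputable def mixture {s : ℕ} (rf : ℝ) (Dr Df : Measure (E s)) : Measure (E s) :=
  ENNReal.ofReal rf • Df + ENNReal.ofReal (1 - rf) • Dr

/-! ### Iterative first-order algorithms -/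

/-- A randomized iterative first-order algorithm on `ℝᵈ`. A seed is drawn once; `init` turns the
initial model into the first query point and memory state (this step sees no data: it may for
instance add noise); `update` turns model, stochastic gradient, memory and seed into the next model
and memory; `output` returns a model after the last iteration. -/
structure Algorithm (d : ℕ) where
  Mem : Type
  Seed : Type
  [measMem : MeasurableSpace Mem]
  [measSeed : MeasurableSpace Seed]
  seedLaw : Measure Seed
  [isProb : IsProbabilityMeasure seedLaw]
  init : E d × Seed → E d × Mem
  update : E d × E d × Mem × Seed → E d × Mem
  output : E d × Mem → E d
  measurable_init : Measurable init
  measurable_update : Measurable update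
  measurable_output : Measurable output

attribute [instance] Algorithm.measMem Algorithm.measSeed Algorithm.isProb

/-- One iteration on (state, seed), using the fresh data point `ξ` through the stochastic gradient
of the loss at the current model. -/
noncomputable def Algorithm.step {d s : ℕ} (A : Algorithm d) (l : E d → E s → ℝ)
    (p : ((E d × A.Mem) × A.Seed) × E s) : (E d × A.Mem) × A.Seed :=
  (A.update (p.1.1.1, gradient (fun η => l η p.2) p.1.1.1, p.1.1.2, p.1.2), p.1.2)

/-- Joint law of (model, memory) and seed after `T` iterations started from `θ₀`, each of which
draws an independent sample from `D`. -/
noncomputable def Algorithm.stateLaw {d s : ℕ} (A : Algorithm d) (l : E d → E s → ℝ)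
    (D : Measure (E s)) (θ₀ : E d) : ℕ → Measure ((E d × A.Mem) × A.Seed)
  | 0 => A.seedLaw.map (fun ω => (A.init (θ₀, ω), ω))
  | T + 1 => ((A.stateLaw l D θ₀ T).prod D).map (A.step l)

/-- Law of the model returned after `T` iterations (i.e. `T` stochastic gradient accesses). -/
noncomputable def Algorithm.outputLaw {d s : ℕ} (A : Algorithm d) (l : E d → E s → ℝ)
    (D : Measure (E s)) (θ₀ : E d) (T : ℕ) : Measure (E d) :=
  (A.stateLaw l D θ₀ T).map (fun p => A.output p.1)

/-- `(ε, δ)`-unlearning: the model returned by the algorithm, started at the minimizer over the full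
distribution and sampling from the retain distribution only, is `(ε, δ)`-indistinguishable when the
forget distribution is replaced by another one. -/
def Algorithm.IsUnlearning {d : ℕ} (A : Algorithm d) (s : ℕ) (μ L rf ε δ : ℝ) : Prop :=
  ∀ l : E d → E s → ℝ, IsSCLoss μ L l →
  ∀ Dr Df Df' : Measure (E s), IsProbabilityMeasure Dr → IsProbabilityMeasure Df →
    IsProbabilityMeasure Df' →
  ∀ θs θs' : E d, IsRiskMinimizer (L / (2 * μ)) l (mixture rf Dr Df) θs →
    IsRiskMinimizer (L / (2 * μ)) l (mixture rf Dr Df') θs' →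
  ∀ T : ℕ, ∀ S : Set (E d), MeasurableSet S →
    A.outputLaw l Dr θs T S
      ≤ ENNReal.ofReal (Real.exp ε) * A.outputLaw l Dr θs' T S + ENNReal.ofReal δ

/-! ### Computation times -/

/-- The expected excess risk (under `D`, relative to its minimizer `θm`) of the output after `T`
iterations started at `θ₀` is well defined and at most `e`. -/
def Algorithm.Reaches {d s : ℕ} (A : Algorithm d) (l : E d → E s → ℝ) (D : Measure (E s))
    (θ₀ θm : E d) (e : ℝ) (T : ℕ) : Prop :=
  Integrable (risk l D) (A.outputLaw l D θ₀ T) ∧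
    ∫ θ, (risk l D θ - risk l D θm) ∂(A.outputLaw l D θ₀ T) ≤ e

/-- The smallest number of iterations from which on the expected excess risk is at most `e`
(`⊤` if there is none). -/
noncomputable def Algorithm.time {d s : ℕ} (A : Algorithm d) (l : E d → E s → ℝ)
    (D : Measure (E s)) (θ₀ θm : E d) (e : ℝ) : ℕ∞ :=
  ⨅ (T : ℕ) (_ : ∀ T' : ℕ, T ≤ T' → A.Reaches l D θ₀ θm e T'), (T : ℕ∞)

/-- Worst-case time over the loss class for retraining from scratch (started at `0`). -/
noncomputable def Algorithm.worstScratchTime {d s : ℕ} (A : Algorithm d) (μ L : ℝ)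
    (Dr : Measure (E s)) (e : ℝ) : ℕ∞ :=
  ⨆ (l : E d → E s → ℝ) (_ : IsSCLoss μ L l) (θr : E d)
    (_ : IsRiskMinimizer (L / (2 * μ)) l Dr θr), A.time l Dr 0 θr e

/-- Worst-case time over the loss class for unlearning (started at the minimizer `θs` of the risk
over the full distribution). -/
noncomputable def Algorithm.worstUnlearnTime {d s : ℕ} (A : Algorithm d) (μ L rf : ℝ)
    (Dr Df : Measure (E s)) (e : ℝ) : ℕ∞ :=
  ⨆ (l : E d → E s → ℝ) (_ : IsSCLoss μ L l) (θr : E d)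
    (_ : IsRiskMinimizer (L / (2 * μ)) l Dr θr) (θs : E d)
    (_ : IsRiskMinimizer (L / (2 * μ)) l (mixture rf Dr Df) θs), A.time l Dr θs θr e

/-- The minimax retraining time `T^S_e`. -/
noncomputable def scratchTime (d : ℕ) {s : ℕ} (μ L : ℝ) (Dr : Measure (E s)) (e : ℝ) : ℕ∞ :=
  ⨅ A : Algorithm d, A.worstScratchTime μ L Dr e

/-- The minimax unlearning time `T^U_e` over the algorithms that achieve `(ε, δ)`-unlearning. -/
noncomputable def unlearnTime (d : ℕ) {s : ℕ} (μ L rf ε δ : ℝ) (Dr Df : Measure (E s))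
    (e : ℝ) : ℕ∞ :=
  ⨅ (A : Algorithm d) (_ : A.IsUnlearning s μ L rf ε δ), A.worstUnlearnTime μ L rf Dr Df e

/-- The privacy strength `κ = ε⁻¹ √(2 ln (1.25 / δ))`. -/
noncomputable def kappa (ε δ : ℝ) : ℝ := ε⁻¹ * Real.sqrt (2 * Real.log (1.25 / δ))

/-- Every probability `p ∈ [0, 1]` is the probability under `D` of some event. -/
def IsFlexible {s : ℕ} (D : Measure (E s)) : Prop :=
  ∀ p : ℝ, 0 ≤ p → p ≤ 1 → ∃ A : Set (E s), MeasurableSet A ∧ D A = ENNReal.ofReal p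

/-! ### Noise and fine-tune -/

/-- Projection onto the closed ball `B(0, R)`. -/
noncomputable def proj {d : ℕ} (R : ℝ) (θ : E d) : E d :=
  open Classical in if ‖θ‖ ≤ R then θ else (R / ‖θ‖) • θ

theorem measurable_proj {d : ℕ} (R : ℝ) : Measurable (proj R : E d → E d) := by
  unfold proj
  refine Measurable.ite (measurableSet_le measurable_norm measurable_const) measurable_id ?_
  exact (measurable_const.div measurable_norm).smul measurable_id

/-- "Noise and fine-tune": add to the initial model a Gaussian noise of law `N(0, σ² I)`, then run
stochastic gradient descent with step size `γ`, projected onto `B(0, R)`, and return the average of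
the iterates. The memory holds the sum of the iterates and their number. -/
noncomputable def noiseFineTune (d : ℕ) (R σ γ : ℝ) : Algorithm d where
  Mem := E d × ℕ
  Seed := E d
  seedLaw := stdGaussian (E d)
  init p := (proj R (p.1 + σ • p.2), (proj R (p.1 + σ • p.2), 1))
  update p := (proj R (p.1 - γ • p.2.1),
    (p.2.2.1.1 + proj R (p.1 - γ • p.2.1), p.2.2.1.2 + 1))
  output q := (q.2.2 : ℝ)⁻¹ • q.2.1
  measurable_init := by
    have h : Measurable (fun p : E d × E d => proj R (p.1 + σ • p.2)) :=
      (measurable_proj R).comp (by fun_prop)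
    exact h.prodMk (h.prodMk measurable_const)
  measurable_update := by
    have h : Measurable (fun p : E d × E d × (E d × ℕ) × E d => proj R (p.1 - γ • p.2.1)) :=
      (measurable_proj R).comp (by fun_prop)
    exact h.prodMk ((Measurable.add (by fun_prop) h).prodMk (by fun_prop))
  measurable_output := by
    have h : Measurable (fun q : E d × (E d × ℕ) => (q.2.2 : ℝ)) :=
      (measurable_from_nat (f := fun n : ℕ => (n : ℝ))).comp (by fun_prop)
    exact h.inv.smul (by fun_prop)

end Unlearning

/-!
# Why noise and fine-tune is efficient

*Privacy and warm start.* Both statements about the unlearning algorithm rest on one stability bound,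
`norm_minimizer_sub_le`: replacing the forget distribution moves the minimizer of the full risk by at
most `4 r_f L / μ`. The two risks are strongly convex, so each grows quadratically away from its own
minimizer, while their difference is `2 r_f L`-Lipschitz. Hence Gaussian noise of scale
`σ = c κ (r_f / (1 - r_f)) L / μ` hides which of two forget distributions was used
(`gaussian_mechanism`), and the fine-tuning steps, which see only retained data, are post-processing
(`outputLaw_noiseFineTune_le`). The usual calibration of the Gaussian mechanism needs `ε ≤ 1`; a
constant `c` growing linearly in the bound on `ε` covers all larger `ε` as well. As the retained
distribution is itself a mixture with forget distribution `D_r`, the same bound says that `θ*` is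
within `4 r_f L / μ` of the minimizer `θ_r*` of the retain risk.

*Upper bound.* Averaged projected stochastic gradient descent with step `γ` satisfies, after `T` steps
and thus with `T + 1` iterates, `excess ≤ 𝔼‖θ₀ - θ_r*‖² / (2 γ (T + 1)) + γ L² / 2`
(`sgdLaw_regret`). For `γ = e / L²` this is at most `e` as soon as
`T + 1 ≥ 𝔼‖θ₀ - θ_r*‖² L² / e²`, where `𝔼‖θ₀ - θ_r*‖² = ‖θ* - θ_r*‖² + d σ²` before projection
(`worstUnlearnTime_noiseFineTune_le`). Without noise and from `0` it bounds the retraining time.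

*Lower bound.* The losses `μ / 2 ‖θ‖² ± χ(ξ) (L / 2) ⟪w, θ⟫`, with a sign `χ` of mean `a` under the
retained distribution, have risk minimizers at distance `a L / μ` from each other, and each gradient
reveals one sign only. The laws of the state after `T` gradients have Hellinger affinity at least
`(1 - a²) ^ (T / 2)` (`affinity_stateLaw`), so no algorithm has excess risk below
`e₀ a² (1 - a²) ^ T` on both (`excess_ge_of_reaches`). The choice `a = 1`, `T = 0` shows that the
retraining time is positive, and `a² = 1 / (2 (T + 1))` that it is at least `e₀ / (8 e)`.
The quotient of the two bounds is the claim.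
-/

namespace Unlearning

/-! ### Projection onto a ball -/

theorem norm_proj_le {d : ℕ} {R : ℝ} (hR : 0 ≤ R) (x : E d) : ‖proj R x‖ ≤ R := by
  unfold proj
  split_ifs with h
  · exact h
  · have hx : 0 < ‖x‖ := hR.trans_lt (not_le.mp h)
    rw [norm_smul, Real.norm_eq_abs, abs_of_nonneg (by positivity), div_mul_cancel₀ _ hx.ne']

theorem proj_of_norm_le {d : ℕ} {R : ℝ} {x : E d} (hx : ‖x‖ ≤ R) : proj R x = x := if_pos hx

/-- Projecting onto the ball does not increase the distance to points of the ball. -/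
theorem norm_proj_sub_le {d : ℕ} {R : ℝ} (hR : 0 ≤ R) (x : E d) {y : E d} (hy : ‖y‖ ≤ R) :
    ‖proj R x - y‖ ≤ ‖x - y‖ := by
  by_cases h : ‖x‖ ≤ R
  · rw [proj_of_norm_le h]
  have hx : 0 < ‖x‖ := hR.trans_lt (not_le.mp h)
  have hp : proj R x = (R / ‖x‖) • x := if_neg h
  have hxy : inner ℝ x y ≤ ‖x‖ * R :=
    (real_inner_le_norm x y).trans (by gcongr)
  rw [hp]
  refine le_of_sq_le_sq ?_ (norm_nonneg _)
  rw [@norm_sub_sq_real, @norm_sub_sq_real, norm_smul, real_inner_smul_left, Real.norm_eq_abs,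
    abs_of_nonneg (by positivity), div_mul_cancel₀ _ hx.ne']
  have h1 : R / ‖x‖ ≤ 1 := (div_le_one hx).2 (not_le.mp h).le
  have h2 : R / ‖x‖ * ‖x‖ = R := div_mul_cancel₀ _ hx.ne'
  nlinarith [mul_le_mul_of_nonneg_left hxy (sub_nonneg.2 h1), not_le.mp h,
    sq_nonneg (‖x‖ - R)]

/-! ### Losses and their gradients -/

section Loss

variable {d s : ℕ} {μ L : ℝ} {l : E d → E s → ℝ}

theorem hasDerivAt_line (h : IsSCLoss μ L l) (ξ : E s) (θ w : E d) :
    HasDerivAt (fun t : ℝ => l (θ + t • w) ξ) (inner ℝ (gradient (fun η => l η ξ) θ) w) 0 := by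
  have h1 := ((h.differentiable ξ) θ).hasGradientAt.hasFDerivAt
  have h2 : HasDerivAt (fun t : ℝ => θ + t • w) w 0 := by
    simpa using ((hasDerivAt_id (0 : ℝ)).smul_const w).const_add θ
  have h3 : HasFDerivAt (fun η => l η ξ)
      ((InnerProductSpace.toDual ℝ (E d)) (gradient (fun η => l η ξ) θ)) (θ + (0 : ℝ) • w) := by
    simpa using h1
  have h4 := h3.comp_hasDerivAt (0 : ℝ) h2
  simp only [InnerProductSpace.toDual_apply_apply] at h4
  exact h4

/-- The gradient is a limit of difference quotients, hence measurable in model and data jointly. -/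
theorem measurable_gradient (h : IsSCLoss μ L l) :
    Measurable (fun p : E d × E s => gradient (fun η => l η p.2) p.1) := by
  have hcoord : ∀ i : Fin d, Measurable
      (fun p : E d × E s => gradient (fun η => l η p.2) p.1 i) := by
    intro i
    set b : E d := EuclideanSpace.single i (1 : ℝ) with hb
    have hlim : ∀ p : E d × E s, Filter.Tendsto
        (fun n : ℕ => (1 / ((n : ℝ) + 1))⁻¹ • (l (p.1 + (1 / ((n : ℝ) + 1)) • b) p.2 - l p.1 p.2))
        Filter.atTop (nhds (gradient (fun η => l η p.2) p.1 i)) := by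
      intro p
      have h1 := (hasDerivAt_line h p.2 p.1 b).tendsto_slope_zero_right
      have h2 : Filter.Tendsto (fun n : ℕ => 1 / ((n : ℝ) + 1)) Filter.atTop
          (nhdsWithin 0 (Set.Ioi 0)) :=
        tendsto_nhdsWithin_iff.2 ⟨tendsto_one_div_add_atTop_nhds_zero_nat,
          Filter.Eventually.of_forall fun n => by simp only [Set.mem_Ioi]; positivity⟩
      have h3 := h1.comp h2
      have h4 : inner ℝ (gradient (fun η => l η p.2) p.1) b
          = gradient (fun η => l η p.2) p.1 i := by
        rw [hb, EuclideanSpace.inner_single_right]; simp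
      rw [h4] at h3
      simpa [Function.comp_def] using h3
    refine measurable_of_tendsto_metrizable (fun n => ?_) (tendsto_pi_nhds.2 hlim)
    have hm := h.measurable
    have e1 : Measurable (fun p : E d × E s => l (p.1 + (1 / ((n : ℝ) + 1)) • b) p.2) :=
      hm.comp ((measurable_fst.add_const _).prodMk measurable_snd)
    have e2 : Measurable (fun p : E d × E s => l p.1 p.2) := hm
    exact (e1.sub e2).const_smul (1 / ((n : ℝ) + 1))⁻¹
  have := (WithLp.measurable_toLp 2 (Fin d → ℝ)).comp (measurable_pi_lambda _ hcoord)
  exact this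

theorem abs_inner_gradient_le_of_inward (h : IsSCLoss μ L l) (ξ : E s) {θ w : E d}
    (hw : ∀ᶠ t in nhdsWithin (0 : ℝ) (Set.Ioi 0), ‖θ + t • w‖ ≤ L / (2 * μ))
    (hθ : ‖θ‖ ≤ L / (2 * μ)) :
    |inner ℝ (gradient (fun η => l η ξ) θ) w| ≤ L * ‖w‖ := by
  have h1 := (hasDerivAt_line h ξ θ w).tendsto_slope_zero_right.abs
  refine le_of_tendsto h1 ?_
  filter_upwards [hw, self_mem_nhdsWithin] with t ht htpos
  have htpos : 0 < t := htpos
  have h2 := h.lipschitz ξ (θ + t • w) θ ht hθ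
  simp only [zero_add, zero_smul, add_zero, smul_eq_mul, abs_mul, abs_inv, abs_of_pos htpos]
  rw [add_sub_cancel_left, norm_smul, Real.norm_eq_abs, abs_of_pos htpos] at h2
  rw [inv_mul_le_iff₀ htpos]
  linarith

/-- The gradients are bounded by the Lipschitz constant up to the boundary of the ball: the
directional derivatives towards the inside are, and these directions, together with their limits and
opposites, are all directions. -/
theorem norm_gradient_le (h : IsSCLoss μ L l) (hL : 0 ≤ L) (hR : 0 < L / (2 * μ)) (ξ : E s) {θ : E d}
    (hθ : ‖θ‖ ≤ L / (2 * μ)) : ‖gradient (fun η => l η ξ) θ‖ ≤ L := by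
  set g := gradient (fun η => l η ξ) θ with hg
  set R := L / (2 * μ) with hRdef
  have hA : ∀ w : E d, (‖θ‖ < R ∨ inner ℝ θ w < 0) → |inner ℝ g w| ≤ L * ‖w‖ := by
    intro w hw
    refine abs_inner_gradient_le_of_inward h ξ ?_ hθ
    rcases hw with hw | hw
    · have hc : Filter.Tendsto (fun t : ℝ => ‖θ + t • w‖) (nhdsWithin 0 (Set.Ioi 0)) (nhds ‖θ‖) := by
        have : Continuous (fun t : ℝ => ‖θ + t • w‖) := by fun_prop
        simpa using (this.tendsto 0).mono_left nhdsWithin_le_nhds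
      filter_upwards [hc.eventually_lt_const hw] with t ht using ht.le
    · have hc : Filter.Tendsto (fun t : ℝ => 2 * inner ℝ θ w + t * ‖w‖ ^ 2)
          (nhdsWithin 0 (Set.Ioi 0)) (nhds (2 * inner ℝ θ w)) := by
        have : Continuous (fun t : ℝ => 2 * inner ℝ θ w + t * ‖w‖ ^ 2) := by fun_prop
        simpa using (this.tendsto 0).mono_left nhdsWithin_le_nhds
      filter_upwards [hc.eventually_lt_const (show 2 * inner ℝ θ w < 0 by linarith),
        self_mem_nhdsWithin] with t ht htpos
      have htpos : 0 < t := htpos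
      refine le_trans (le_of_sq_le_sq ?_ (norm_nonneg _)) hθ
      rw [@norm_add_sq_real, real_inner_smul_right, norm_smul, mul_pow, Real.norm_eq_abs, sq_abs]
      nlinarith
  have hB : ∀ w : E d, inner ℝ θ w ≤ 0 → |inner ℝ g w| ≤ L * ‖w‖ := by
    intro w hw
    rcases hθ.lt_or_eq with hlt | heq
    · exact hA w (Or.inl hlt)
    have hc1 : Filter.Tendsto (fun t : ℝ => |inner ℝ g (w - t • θ)|)
        (nhdsWithin 0 (Set.Ioi 0)) (nhds |inner ℝ g w|) := by
      have : Continuous (fun t : ℝ => |inner ℝ g (w - t • θ)|) := by fun_prop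
      simpa using (this.tendsto 0).mono_left nhdsWithin_le_nhds
    have hc2 : Filter.Tendsto (fun t : ℝ => L * ‖w - t • θ‖)
        (nhdsWithin 0 (Set.Ioi 0)) (nhds (L * ‖w‖)) := by
      have : Continuous (fun t : ℝ => L * ‖w - t • θ‖) := by fun_prop
      simpa using (this.tendsto 0).mono_left nhdsWithin_le_nhds
    refine le_of_tendsto_of_tendsto hc1 hc2 ?_
    filter_upwards [self_mem_nhdsWithin] with t ht
    have ht : 0 < t := ht
    refine hA _ (Or.inr ?_)
    rw [inner_sub_right, real_inner_smul_right, real_inner_self_eq_norm_sq, heq]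
    nlinarith [mul_pos ht (pow_pos hR 2)]
  have hfin : |inner ℝ g g| ≤ L * ‖g‖ := by
    rcases le_total (inner ℝ θ g) 0 with h0 | h0
    · exact hB g h0
    · have := hB (-g) (by rw [inner_neg_right]; linarith)
      simpa [inner_neg_right, abs_neg, norm_neg] using this
  rw [real_inner_self_eq_norm_sq, abs_of_nonneg (by positivity)] at hfin
  rcases (norm_nonneg g).eq_or_lt with h0 | h0
  · exact h0 ▸ hL
  · nlinarith

/-- Strong convexity along a segment, from its first-order form at the point of the segment. -/
theorem loss_segment_le (h : IsSCLoss μ L l) (ξ : E s) {x y : E d} {a b : ℝ}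
    (hx : ‖x‖ ≤ L / (2 * μ)) (hy : ‖y‖ ≤ L / (2 * μ)) (ha : 0 ≤ a) (hb : 0 ≤ b) (hab : a + b = 1) :
    l (a • x + b • y) ξ + a * b * (μ / 2 * ‖x - y‖ ^ 2) ≤ a * l x ξ + b * l y ξ := by
  set m := a • x + b • y with hm
  have hmb : ‖m‖ ≤ L / (2 * μ) := by
    calc ‖m‖ ≤ a * ‖x‖ + b * ‖y‖ := by
          refine (norm_add_le _ _).trans ?_
          rw [norm_smul, norm_smul, Real.norm_of_nonneg ha, Real.norm_of_nonneg hb]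
      _ ≤ a * (L / (2 * μ)) + b * (L / (2 * μ)) := by gcongr
      _ = L / (2 * μ) := by rw [← add_mul, hab, one_mul]
  have h1 := h.strongly_convex ξ m x hmb hx
  have h2 := h.strongly_convex ξ m y hmb hy
  have e1 : x - m = b • (x - y) := by
    rw [hm, show a = 1 - b by linarith]; module
  have e2 : y - m = (-a) • (x - y) := by
    rw [hm, show b = 1 - a by linarith]; module
  rw [e1, real_inner_smul_right, norm_smul, mul_pow, Real.norm_eq_abs, sq_abs] at h1
  rw [e2, real_inner_smul_right, norm_smul, mul_pow, Real.norm_eq_abs, sq_abs] at h2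
  have h1' := mul_le_mul_of_nonneg_left h1 ha
  have h2' := mul_le_mul_of_nonneg_left h2 hb
  have hb' : b = 1 - a := by linarith
  subst hb'
  nlinarith

end Loss

/-! ### Risks and their minimizers -/

section Risk

variable {d s : ℕ} {μ L : ℝ} {l : E d → E s → ℝ}

theorem measurable_risk (h : IsSCLoss μ L l) (D : Measure (E s)) [SFinite D] :
    Measurable (risk l D) :=
  (h.measurable.stronglyMeasurable.integral_prod_right (ν := D)).measurable

theorem integral_sub_le (h : IsSCLoss μ L l) {D : Measure (E s)} [IsFiniteMeasure D]
    (hi : ∀ θ, Integrable (l θ) D) {x y : E d} (hx : ‖x‖ ≤ L / (2 * μ)) (hy : ‖y‖ ≤ L / (2 * μ)) :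
    |∫ ξ, l x ξ ∂D - ∫ ξ, l y ξ ∂D| ≤ L * ‖x - y‖ * D.real Set.univ := by
  rw [← integral_sub (hi x) (hi y), ← Real.norm_eq_abs]
  exact norm_integral_le_of_norm_le_const
    (Filter.Eventually.of_forall fun ξ => h.lipschitz ξ x y hx hy)

theorem risk_segment_le (h : IsSCLoss μ L l) {D : Measure (E s)} [IsProbabilityMeasure D]
    (hi : ∀ θ, Integrable (l θ) D) {x y : E d} {a b : ℝ}
    (hx : ‖x‖ ≤ L / (2 * μ)) (hy : ‖y‖ ≤ L / (2 * μ)) (ha : 0 ≤ a) (hb : 0 ≤ b) (hab : a + b = 1) :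
    risk l D (a • x + b • y) + a * b * (μ / 2 * ‖x - y‖ ^ 2) ≤ a * risk l D x + b * risk l D y := by
  have h1 := integral_mono (μ := D)
    ((hi (a • x + b • y)).add (integrable_const (a * b * (μ / 2 * ‖x - y‖ ^ 2))))
    (((hi x).const_mul a).add ((hi y).const_mul b)) (fun ξ => loss_segment_le h ξ hx hy ha hb hab)
  simp only [Pi.add_apply] at h1
  rw [integral_add (hi _) (integrable_const _),
    integral_add ((hi x).const_mul a) ((hi y).const_mul b),
    integral_const, probReal_univ, one_smul, integral_const_mul, integral_const_mul] at h1
  exact h1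

theorem IsRiskMinimizer.le {R : ℝ} {D : Measure (E s)} {θ : E d} (h : IsRiskMinimizer R l D θ)
    (θ' : E d) : risk l D θ ≤ risk l D θ' := by
  rcases eq_or_ne θ' θ with rfl | hne
  · exact le_rfl
  · exact (h.lt θ' hne).le

/-- Quadratic growth around a minimizer, from strong convexity at the midpoint. -/
theorem IsRiskMinimizer.growth (h : IsSCLoss μ L l) {D : Measure (E s)} [IsProbabilityMeasure D]
    {θ : E d} (hm : IsRiskMinimizer (L / (2 * μ)) l D θ) {y : E d} (hy : ‖y‖ ≤ L / (2 * μ)) :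
    μ / 4 * ‖θ - y‖ ^ 2 ≤ risk l D y - risk l D θ := by
  have h1 := risk_segment_le (a := 1 / 2) (b := 1 / 2) h hm.integrable hm.norm_le hy
    (by norm_num) (by norm_num) (by norm_num)
  have h2 := hm.le ((1 / 2 : ℝ) • θ + (1 / 2 : ℝ) • y)
  linarith

theorem isProbabilityMeasure_mixture {rf : ℝ} (h0 : 0 ≤ rf) (h1 : rf < 1)
    (Dr Df : Measure (E s)) [IsProbabilityMeasure Dr] [IsProbabilityMeasure Df] :
    IsProbabilityMeasure (mixture rf Dr Df) := by
  constructor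
  simp only [mixture, Measure.coe_add, Measure.coe_smul, Pi.add_apply, Pi.smul_apply, measure_univ,
    smul_eq_mul, mul_one]
  rw [← ENNReal.ofReal_add h0 (by linarith)]
  simp

theorem mixture_self {rf : ℝ} (h0 : 0 ≤ rf) (h1 : rf < 1) (Dr : Measure (E s)) :
    mixture rf Dr Dr = Dr := by
  rw [mixture, ← add_smul, ← ENNReal.ofReal_add h0 (by linarith)]
  simp

/-- Changing a fraction `r_f` of the data moves the minimizer by at most `4 r_f L / μ`: each of the
two risks grows quadratically away from its own minimizer, and their difference is `2 r_f L`-Lipschitz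
because the retained parts cancel. -/
theorem norm_minimizer_sub_le (h : IsSCLoss μ L l) (hμ : 0 < μ) (hL : 0 < L) {rf : ℝ} (h0 : 0 ≤ rf)
    (h1 : rf < 1) {Dr Df Df' : Measure (E s)} [IsProbabilityMeasure Dr] [IsProbabilityMeasure Df]
    [IsProbabilityMeasure Df'] {θ θ' : E d}
    (hm : IsRiskMinimizer (L / (2 * μ)) l (mixture rf Dr Df) θ)
    (hm' : IsRiskMinimizer (L / (2 * μ)) l (mixture rf Dr Df') θ') :
    ‖θ - θ'‖ ≤ 4 * rf * L / μ := by
  have := isProbabilityMeasure_mixture h0 h1 Dr Df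
  have := isProbabilityMeasure_mixture h0 h1 Dr Df'
  have g1 := hm.growth h hm'.norm_le
  have g2 := hm'.growth h hm.norm_le
  have hmass : ∀ (D : Measure (E s)) [IsProbabilityMeasure D],
      (ENNReal.ofReal rf • D).real Set.univ = rf := by
    intro D _
    simp [Measure.real, ENNReal.toReal_ofReal h0]
  have hsplit : ∀ {D : Measure (E s)} {t : E d},
      IsRiskMinimizer (L / (2 * μ)) l (mixture rf Dr D) t → ∀ x,
      risk l (mixture rf Dr D) x = ∫ ξ, l x ξ ∂(ENNReal.ofReal rf • D)
        + ∫ ξ, l x ξ ∂(ENNReal.ofReal (1 - rf) • Dr) := by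
    intro D t ht x
    exact integral_add_measure (ht.integrable x).left_of_add_measure
      (ht.integrable x).right_of_add_measure
  have hfin : ∀ (D : Measure (E s)) [IsProbabilityMeasure D],
      IsFiniteMeasure (ENNReal.ofReal rf • D) :=
    fun D _ => D.smul_finite ENNReal.ofReal_ne_top
  have := hfin Df
  have := hfin Df'
  have k1 := integral_sub_le h (D := ENNReal.ofReal rf • Df)
    (fun x => (hm.integrable x).left_of_add_measure) hm'.norm_le hm.norm_le
  have k2 := integral_sub_le h (D := ENNReal.ofReal rf • Df')
    (fun x => (hm'.integrable x).left_of_add_measure) hm.norm_le hm'.norm_le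
  rw [hmass] at k1 k2
  rw [hsplit hm, hsplit hm] at g1
  rw [hsplit hm', hsplit hm'] at g2
  rw [norm_sub_rev] at k1 g2
  have k1' := (abs_le.1 k1).2
  have k2' := (abs_le.1 k2).2
  have key : μ / 2 * ‖θ - θ'‖ ^ 2 ≤ 2 * (L * ‖θ - θ'‖ * rf) := by linarith
  rw [le_div_iff₀ hμ]
  rcases (norm_nonneg (θ - θ')).eq_or_lt with hz | hz
  · rw [← hz]; simp; positivity
  · nlinarith

end Risk

/-! ### Gaussian noise -/

theorem lintegral_gaussianReal_add (v : ℝ) {f : ℝ → ℝ≥0∞} (hf : Measurable f) :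
    ∫⁻ x, f (x + v) ∂gaussianReal 0 1
      = ∫⁻ x, ENNReal.ofReal (Real.exp (v * x - v ^ 2 / 2)) * f x ∂gaussianReal 0 1 := by
  rw [← lintegral_map (g := fun x => x + v) hf (by fun_prop), gaussianReal_map_add_const,
    gaussianReal_of_var_ne_zero _ one_ne_zero, gaussianReal_of_var_ne_zero _ one_ne_zero,
    lintegral_withDensity_eq_lintegral_mul _ (measurable_gaussianPDF _ _) hf,
    lintegral_withDensity_eq_lintegral_mul _ (measurable_gaussianPDF _ _) (by fun_prop)]
  refine lintegral_congr fun x => ?_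
  simp only [Pi.mul_apply]
  rw [← mul_assoc, gaussianPDF, gaussianPDF, ← ENNReal.ofReal_mul (gaussianPDFReal_nonneg _ _ _),
    gaussianPDFReal, gaussianPDFReal, mul_assoc, mul_assoc, ← Real.exp_add]
  congr 5
  simp
  ring

theorem lintegral_pi_prod {ι : Type*} [Fintype ι] (ν : ι → Measure ℝ)
    [∀ i, IsProbabilityMeasure (ν i)] {f : ι → ℝ → ℝ≥0∞} (hf : ∀ i, Measurable (f i)) :
    ∫⁻ x, ∏ i, f i (x i) ∂Measure.pi ν = ∏ i, ∫⁻ x, f i x ∂ν i := by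
  rw [lintegral_prod_eq_prod_lintegral_of_indepFun Finset.univ (fun i (x : ι → ℝ) => f i (x i))
    (iIndepFun_pi (fun i => (hf i).aemeasurable)) (fun i => (hf i).comp (measurable_pi_apply i))]
  refine Finset.prod_congr rfl fun i _ => ?_
  exact (measurePreserving_eval ν i).lintegral_comp (hf i)

theorem pi_gaussianReal_eq_withDensity {ι : Type*} [Fintype ι] (v : ι → ℝ) :
    Measure.pi (fun i => gaussianReal (v i) 1)
      = (Measure.pi (fun _ : ι => gaussianReal 0 1)).withDensity
        (fun x => ∏ i, ENNReal.ofReal (Real.exp (v i * x i - v i ^ 2 / 2))) := by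
  refine Measure.pi_eq fun S hS => ?_
  rw [withDensity_apply _ (MeasurableSet.univ_pi hS),
    ← lintegral_indicator (MeasurableSet.univ_pi hS)]
  have h1 : ∀ x : ι → ℝ, (Set.univ.pi S).indicator
      (fun x => ∏ i, ENNReal.ofReal (Real.exp (v i * x i - v i ^ 2 / 2))) x
      = ∏ i, (S i).indicator (fun y => ENNReal.ofReal (Real.exp (v i * y - v i ^ 2 / 2))) (x i) := by
    intro x
    by_cases hx : x ∈ Set.univ.pi S
    · rw [Set.indicator_of_mem hx]
      exact Finset.prod_congr rfl fun i _ => by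
        rw [Set.indicator_of_mem (hx i trivial)]
    · rw [Set.indicator_of_notMem hx]
      simp only [Set.mem_pi, Set.mem_univ, true_implies, not_forall] at hx
      obtain ⟨i, hi⟩ := hx
      exact (Finset.prod_eq_zero (Finset.mem_univ i) (Set.indicator_of_notMem hi _)).symm
  simp_rw [h1]
  rw [lintegral_pi_prod _ (fun i => Measurable.indicator (by fun_prop) (hS i))]
  refine Finset.prod_congr rfl fun i _ => ?_
  have h2 := lintegral_gaussianReal_add (v i) (f := (S i).indicator 1)
    (measurable_one.indicator (hS i))
  rw [← lintegral_map (g := fun x => x + v i) (measurable_one.indicator (hS i)) (by fun_prop),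
    gaussianReal_map_add_const, lintegral_indicator_one (hS i), zero_add] at h2
  rw [h2]
  refine lintegral_congr fun x => ?_
  by_cases hx : x ∈ S i <;> simp [hx]

/-- The Cameron–Martin formula for the standard Gaussian measure. -/
theorem lintegral_stdGaussian_add {d : ℕ} (v : E d) {f : E d → ℝ≥0∞} (hf : Measurable f) :
    ∫⁻ z, f (z + v) ∂stdGaussian (E d)
      = ∫⁻ z, ENNReal.ofReal (Real.exp (inner ℝ v z - ‖v‖ ^ 2 / 2)) * f z ∂stdGaussian (E d) := by
  have hT : Measurable (WithLp.toLp 2 : (Fin d → ℝ) → E d) := WithLp.measurable_toLp 2 _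
  rw [← map_pi_eq_stdGaussian, lintegral_map (by fun_prop) hT, lintegral_map (by fun_prop) hT]
  have h1 : (Measure.pi (fun _ : Fin d => gaussianReal 0 1)).map (fun x i => x i + v i)
      = Measure.pi (fun i => gaussianReal (v i) 1) := by
    rw [Measure.pi_map_pi (μ := fun _ : Fin d => gaussianReal 0 1) (f := fun i y => y + v i)
      (fun i => by fun_prop)]
    simp [gaussianReal_map_add_const]
  have hfT : Measurable (fun y : Fin d → ℝ => f (WithLp.toLp 2 y)) := hf.comp hT
  have h2 : ∀ x : Fin d → ℝ, WithLp.toLp 2 x + v = WithLp.toLp 2 (fun i => x i + v i) := by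
    intro x; ext i; simp
  simp_rw [h2]
  rw [← lintegral_map (μ := Measure.pi fun _ : Fin d => gaussianReal 0 1)
    (f := fun y : Fin d → ℝ => f (WithLp.toLp 2 y)) (g := fun x i => x i + v i)
    hfT (by fun_prop), h1, pi_gaussianReal_eq_withDensity,
    lintegral_withDensity_eq_lintegral_mul _ (by fun_prop) hfT]
  refine lintegral_congr fun x => ?_
  simp only [Pi.mul_apply]
  congr 1
  rw [← ENNReal.ofReal_prod_of_nonneg (fun i _ => (Real.exp_pos _).le), ← Real.exp_sum,
    Finset.sum_sub_distrib, ← Finset.sum_div, EuclideanSpace.real_norm_sq_eq, PiLp.inner_apply]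
  congr 3
  refine Finset.sum_congr rfl fun i _ => ?_
  simp [mul_comm]

/-- The Chernoff bound: by the Cameron–Martin formula the exponential moment is that of a shifted
probability measure. -/
theorem stdGaussian_inner_ge_le {d : ℕ} {u : E d} (hu : ‖u‖ = 1) {a : ℝ} (ha : 0 ≤ a) :
    stdGaussian (E d) {z | a ≤ inner ℝ u z} ≤ ENNReal.ofReal (Real.exp (-(a ^ 2 / 2))) := by
  have h1 := lintegral_stdGaussian_add (a • u) (f := fun _ => 1) measurable_const
  simp only [lintegral_const, measure_univ, mul_one] at h1
  have hS : MeasurableSet {z : E d | a ≤ inner ℝ u z} :=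
    measurableSet_le measurable_const (by fun_prop)
  rw [← lintegral_indicator_one hS, ← mul_one (ENNReal.ofReal _), h1,
    ← lintegral_const_mul _ (by fun_prop)]
  refine lintegral_mono fun z => ?_
  by_cases hz : z ∈ {z : E d | a ≤ inner ℝ u z}
  · rw [Set.indicator_of_mem hz, Pi.one_apply, ← ENNReal.ofReal_mul (Real.exp_pos _).le,
      ← Real.exp_add, ENNReal.one_le_ofReal, Real.one_le_exp_iff, real_inner_smul_left, norm_smul,
      hu, Real.norm_of_nonneg ha]
    have hz : a ≤ inner ℝ u z := hz
    nlinarith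
  · rw [Set.indicator_of_notMem hz]
    exact zero_le

/-- The shift of a standard Gaussian by `v` is `(ε, δ)`-indistinguishable from it: where the
log-density `⟪v, z⟫ - ‖v‖² / 2` is at most `ε` the densities compare, and the complement is a
Gaussian tail. -/
theorem stdGaussian_shift_le {d : ℕ} (v : E d) {a ε δ : ℝ} (ha : 0 ≤ a) (hε : 0 ≤ ε)
    (hv : ‖v‖ * (a + ‖v‖ / 2) ≤ ε) (hδ : Real.exp (-(a ^ 2 / 2)) ≤ δ) {S : Set (E d)}
    (hS : MeasurableSet S) :
    stdGaussian (E d) {z | z + v ∈ S}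
      ≤ ENNReal.ofReal (Real.exp ε) * stdGaussian (E d) S + ENNReal.ofReal δ := by
  rcases eq_or_ne v 0 with rfl | hv0
  · simp only [add_zero, Set.ofPred_mem_eq]
    refine le_add_right (le_mul_of_one_le_left (zero_le) ?_)
    rw [ENNReal.one_le_ofReal]
    exact Real.one_le_exp hε
  have hvpos : 0 < ‖v‖ := norm_pos_iff.2 hv0
  set B : Set (E d) := {z | inner ℝ v z - ‖v‖ ^ 2 / 2 ≤ ε} with hB
  have hBm : MeasurableSet B := measurableSet_le (by fun_prop) measurable_const
  have hsub : {z | z + v ∈ S} ⊆ {z | z + v ∈ S ∩ B} ∪ {z | a ≤ inner ℝ (‖v‖⁻¹ • v) z} := by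
    intro z hz
    by_cases hzB : z + v ∈ B
    · exact Or.inl ⟨hz, hzB⟩
    · refine Or.inr ?_
      simp only [hB, Set.mem_ofPred_eq, not_le, inner_add_right, real_inner_self_eq_norm_sq] at hzB
      rw [Set.mem_ofPred_eq, real_inner_smul_left, le_inv_mul_iff₀ hvpos]
      nlinarith
  refine (measure_mono hsub).trans ((measure_union_le _ _).trans (add_le_add ?_ ?_))
  · have hSB := hS.inter hBm
    have h1 := lintegral_stdGaussian_add v (f := (S ∩ B).indicator 1) (measurable_one.indicator hSB)
    have h2 : ∫⁻ z, (S ∩ B).indicator (1 : E d → ℝ≥0∞) (z + v) ∂stdGaussian (E d)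
        = stdGaussian (E d) {z | z + v ∈ S ∩ B} := by
      have : MeasurableSet {z | z + v ∈ S ∩ B} := (measurable_id.add_const v) hSB
      rw [← lintegral_indicator_one this]
      rfl
    rw [← h2, h1, ← lintegral_indicator_one hS,
      ← lintegral_const_mul _ (measurable_one.indicator hS)]
    refine lintegral_mono fun z => ?_
    by_cases hz : z ∈ S ∩ B
    · rw [Set.indicator_of_mem hz, Set.indicator_of_mem hz.1]
      gcongr
      exact hz.2
    · rw [Set.indicator_of_notMem hz, mul_zero]
      exact zero_le
  · refine (stdGaussian_inner_ge_le ?_ ha).trans (ENNReal.ofReal_le_ofReal hδ)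
    rw [norm_smul, norm_inv, norm_norm, inv_mul_cancel₀ hvpos.ne']

theorem gaussian_mechanism {d : ℕ} (x y : E d) {σ a ε δ : ℝ} (hσ : 0 < σ) (ha : 0 ≤ a) (hε : 0 ≤ ε)
    (hxy : ‖x - y‖ / σ * (a + ‖x - y‖ / σ / 2) ≤ ε) (hδ : Real.exp (-(a ^ 2 / 2)) ≤ δ)
    {S : Set (E d)} (hS : MeasurableSet S) :
    (stdGaussian (E d)).map (fun z => x + σ • z) S
      ≤ ENNReal.ofReal (Real.exp ε) * (stdGaussian (E d)).map (fun z => y + σ • z) S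
        + ENNReal.ofReal δ := by
  have hm : ∀ x : E d, Measurable (fun z : E d => x + σ • z) := fun x => by fun_prop
  rw [Measure.map_apply (hm x) hS, Measure.map_apply (hm y) hS]
  have hn : ‖σ⁻¹ • (x - y)‖ = ‖x - y‖ / σ := by
    rw [norm_smul, norm_inv, Real.norm_of_nonneg hσ.le]; ring
  have h1 := stdGaussian_shift_le (σ⁻¹ • (x - y)) ha hε (by rw [hn]; exact hxy) hδ (hm y hS)
  convert h1 using 3
  ext z
  simp only [Set.mem_preimage, Set.mem_ofPred_eq, smul_add, smul_smul, mul_inv_cancel₀ hσ.ne',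
    one_smul]
  rw [show y + (σ • z + (x - y)) = x + σ • z by abel]

theorem integral_norm_add_smul_sq {d : ℕ} (b : E d) (σ : ℝ) :
    Integrable (fun z => ‖b + σ • z‖ ^ 2) (stdGaussian (E d)) ∧
      ∫ z, ‖b + σ • z‖ ^ 2 ∂stdGaussian (E d) = ‖b‖ ^ 2 + d * σ ^ 2 := by
  have hL2 : MemLp id 2 (stdGaussian (E d)) := IsGaussian.memLp_two_id
  have hn : Integrable (fun z : E d => ‖z‖ ^ 2) (stdGaussian (E d)) :=
    hL2.integrable_norm_pow (by norm_num)
  have hid : Integrable (fun z : E d => z) (stdGaussian (E d)) := IsGaussian.integrable_id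
  have hin : Integrable (fun z : E d => inner ℝ b z) (stdGaussian (E d)) := hid.const_inner b
  have hcoord : ∀ i : Fin d, Integrable (fun z : E d => z i ^ 2) (stdGaussian (E d)) ∧
      ∫ z, z i ^ 2 ∂stdGaussian (E d) = 1 := by
    intro i
    have h1 := variance_dual_stdGaussian (innerSL ℝ (EuclideanSpace.single i (1 : ℝ)) : E d →L[ℝ] ℝ)
    rw [variance_of_integral_eq_zero (by fun_prop) (integral_strongDual_stdGaussian _)] at h1
    refine ⟨?_, by simpa [EuclideanSpace.inner_single_left] using h1⟩
    refine hn.mono (by fun_prop) (Filter.Eventually.of_forall fun z => ?_)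
    rw [norm_pow, norm_pow, norm_norm]
    gcongr
    exact PiLp.norm_apply_le z i
  have hexp : ∀ z : E d, ‖b + σ • z‖ ^ 2 = ‖b‖ ^ 2 + 2 * σ * inner ℝ b z + σ ^ 2 * ‖z‖ ^ 2 := by
    intro z
    rw [@norm_add_sq_real, real_inner_smul_right, norm_smul, mul_pow, Real.norm_eq_abs, sq_abs]
    ring
  have hi1 : Integrable (fun z : E d => ‖b‖ ^ 2 + 2 * σ * inner ℝ b z) (stdGaussian (E d)) :=
    (integrable_const _).add (hin.const_mul _)
  simp_rw [hexp]
  refine ⟨hi1.add (hn.const_mul _), ?_⟩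
  rw [integral_add hi1 (hn.const_mul _), integral_add (integrable_const _) (hin.const_mul _),
    integral_const_mul, integral_const_mul]
  have h0 : ∫ z, inner ℝ b z ∂stdGaussian (E d) = 0 := by
    rw [integral_inner hid, integral_id_stdGaussian, inner_zero_right]
  have hd : ∫ z, ‖z‖ ^ 2 ∂stdGaussian (E d) = d := by
    simp_rw [EuclideanSpace.real_norm_sq_eq]
    rw [integral_finsetSum _ (fun i _ => (hcoord i).1)]
    simp [(hcoord _).2]
  rw [h0, hd]
  simp
  ring

/-! ### The Markov chain of an algorithm -/

section Chain

variable {d s : ℕ} {μ L : ℝ} {l : E d → E s → ℝ}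

theorem Algorithm.measurable_step (A : Algorithm d) (h : IsSCLoss μ L l) :
    Measurable (A.step l (s := s)) := by
  have hg : Measurable (fun p : ((E d × A.Mem) × A.Seed) × E s =>
      gradient (fun η => l η p.2) p.1.1.1) :=
    (measurable_gradient h).comp ((measurable_fst.comp (measurable_fst.comp measurable_fst)).prodMk
      measurable_snd)
  refine (A.measurable_update.comp ?_).prodMk (by fun_prop)
  exact Measurable.prodMk (by fun_prop) (hg.prodMk (by fun_prop))

theorem Algorithm.isProbabilityMeasure_stateLaw (A : Algorithm d) (h : IsSCLoss μ L l)
    (D : Measure (E s)) [IsProbabilityMeasure D] (θ₀ : E d) (T : ℕ) :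
    IsProbabilityMeasure (A.stateLaw l D θ₀ T) := by
  induction T with
  | zero =>
    have : Measurable (fun ω => (A.init (θ₀, ω), ω)) :=
      (A.measurable_init.comp (measurable_const.prodMk measurable_id)).prodMk measurable_id
    exact Measure.isProbabilityMeasure_map this.aemeasurable
  | succ T ih =>
    exact Measure.isProbabilityMeasure_map (A.measurable_step h).aemeasurable

/-- One step of projected stochastic gradient descent on the current iterate, the sum of the
iterates and their number. -/
noncomputable def sgdStep (R γ : ℝ) (l : E d → E s → ℝ) (p : (E d × (E d × ℕ)) × E s) :
    E d × (E d × ℕ) :=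
  (proj R (p.1.1 - γ • gradient (fun η => l η p.2) p.1.1),
    (p.1.2.1 + proj R (p.1.1 - γ • gradient (fun η => l η p.2) p.1.1), p.1.2.2 + 1))

/-- Law of the iterate, the sum of the iterates and their number after `T` steps of "noise and
fine-tune", without the seed, which is used only for the initial noise. -/
noncomputable def sgdLaw (R σ γ : ℝ) (l : E d → E s → ℝ) (D : Measure (E s)) (θ₀ : E d) :
    ℕ → Measure (E d × (E d × ℕ))
  | 0 => ((stdGaussian (E d)).map (fun z => θ₀ + σ • z)).map (fun x => (proj R x, (proj R x, 1)))
  | T + 1 => ((sgdLaw R σ γ l D θ₀ T).prod D).map (sgdStep R γ l)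

theorem measurable_sgdStep (h : IsSCLoss μ L l) (R γ : ℝ) : Measurable (sgdStep R γ l (s := s)) := by
  have hg : Measurable (fun p : (E d × (E d × ℕ)) × E s => gradient (fun η => l η p.2) p.1.1) :=
    (measurable_gradient h).comp ((measurable_fst.comp measurable_fst).prodMk measurable_snd)
  have hp : Measurable (fun p : (E d × (E d × ℕ)) × E s =>
      proj R (p.1.1 - γ • gradient (fun η => l η p.2) p.1.1)) :=
    (measurable_proj R).comp ((measurable_fst.comp measurable_fst).sub (hg.const_smul γ))
  exact hp.prodMk ((Measurable.add (by fun_prop) hp).prodMk (by fun_prop))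

theorem measurable_sgdInit (R : ℝ) :
    Measurable (fun x : E d => (proj R x, (proj R x, 1)) : E d → E d × (E d × ℕ)) :=
  (measurable_proj R).prodMk ((measurable_proj R).prodMk measurable_const)

theorem isProbabilityMeasure_sgdLaw (h : IsSCLoss μ L l) (R σ γ : ℝ) (D : Measure (E s))
    [IsProbabilityMeasure D] (θ₀ : E d) (T : ℕ) :
    IsProbabilityMeasure (sgdLaw R σ γ l D θ₀ T) := by
  induction T with
  | zero =>
    have : IsProbabilityMeasure ((stdGaussian (E d)).map (fun z => θ₀ + σ • z)) :=
      Measure.isProbabilityMeasure_map (by fun_prop)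
    exact Measure.isProbabilityMeasure_map (measurable_sgdInit R).aemeasurable
  | succ T ih => exact Measure.isProbabilityMeasure_map (measurable_sgdStep h R γ).aemeasurable

/-- Once the seed is forgotten, the chain of "noise and fine-tune" is that of stochastic gradient
descent from a noisy initial point. -/
theorem map_fst_stateLaw_noiseFineTune (h : IsSCLoss μ L l) (R σ γ : ℝ) (D : Measure (E s))
    [IsProbabilityMeasure D] (θ₀ : E d) (T : ℕ) :
    ((noiseFineTune d R σ γ).stateLaw l D θ₀ T).map Prod.fst = sgdLaw R σ γ l D θ₀ T := by
  induction T with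
  | zero =>
    have hm : Measurable (fun z : E d => θ₀ + σ • z) := by fun_prop
    have hi := (measurable_sgdInit (d := d) R).comp hm
    have hi2 : Measurable (fun ω => ((noiseFineTune d R σ γ).init (θ₀, ω), ω)) :=
      ((noiseFineTune d R σ γ).measurable_init.comp
        (measurable_const.prodMk measurable_id)).prodMk measurable_id
    rw [Algorithm.stateLaw, sgdLaw, Measure.map_map measurable_fst hi2,
      Measure.map_map (measurable_sgdInit R) hm]
    rfl
  | succ T ih =>
    have := (noiseFineTune d R σ γ).isProbabilityMeasure_stateLaw h D θ₀ T
    rw [Algorithm.stateLaw, sgdLaw, ← ih,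
      Measure.map_map measurable_fst ((noiseFineTune d R σ γ).measurable_step h)]
    have h1 := Measure.map_prod_map ((noiseFineTune d R σ γ).stateLaw l D θ₀ T) D
      (f := Prod.fst) (g := id) measurable_fst measurable_id
    rw [Measure.map_id] at h1
    have h2 : Measurable (Prod.map (Prod.fst : (E d × (noiseFineTune d R σ γ).Mem) ×
        (noiseFineTune d R σ γ).Seed → _) (id : E s → E s)) := measurable_fst.prodMap measurable_id
    have h3 := Measure.map_map (μ := ((noiseFineTune d R σ γ).stateLaw l D θ₀ T).prod D)
      (measurable_sgdStep h R γ) h2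
    refine Eq.trans ?_ (Eq.trans h3.symm (congrArg (Measure.map (sgdStep R γ l)) h1.symm))
    rfl

theorem measurable_average :
    Measurable (fun q : E d × (E d × ℕ) => (q.2.2 : ℝ)⁻¹ • q.2.1) := by
  have h : Measurable (fun q : E d × (E d × ℕ) => (q.2.2 : ℝ)) :=
    (measurable_from_nat (f := fun n : ℕ => (n : ℝ))).comp (by fun_prop)
  exact h.inv.smul (by fun_prop)

theorem outputLaw_noiseFineTune (h : IsSCLoss μ L l) (R σ γ : ℝ) (D : Measure (E s))
    [IsProbabilityMeasure D] (θ₀ : E d) (T : ℕ) :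
    (noiseFineTune d R σ γ).outputLaw l D θ₀ T
      = (sgdLaw R σ γ l D θ₀ T).map (fun q => (q.2.2 : ℝ)⁻¹ • q.2.1) := by
  rw [← map_fst_stateLaw_noiseFineTune h]
  exact (Measure.map_map (measurable_average (d := d)) measurable_fst).symm

end Chain

/-! ### Convergence of noise and fine-tune -/

section Convergence

variable {d s : ℕ} {μ L : ℝ} {l : E d → E s → ℝ}

/-- After `T` steps there are `T + 1` iterates, and the last iterate and the average lie in the ball. -/
theorem sgdLaw_invariant (h : IsSCLoss μ L l) {R : ℝ} (hR : 0 ≤ R) (σ γ : ℝ) (D : Measure (E s))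
    [IsProbabilityMeasure D] (θ₀ : E d) (T : ℕ) :
    ∀ᵐ q ∂sgdLaw R σ γ l D θ₀ T,
      ‖q.1‖ ≤ R ∧ ‖((T : ℝ) + 1)⁻¹ • q.2.1‖ ≤ R ∧ q.2.2 = T + 1 := by
  have hmeas : ∀ T : ℕ, MeasurableSet {q : E d × (E d × ℕ) |
      ‖q.1‖ ≤ R ∧ ‖((T : ℝ) + 1)⁻¹ • q.2.1‖ ≤ R ∧ q.2.2 = T + 1} := by
    intro T
    have m1 : MeasurableSet {q : E d × (E d × ℕ) | ‖q.1‖ ≤ R} :=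
      measurableSet_le (by fun_prop) measurable_const
    have m2 : MeasurableSet {q : E d × (E d × ℕ) | ‖((T : ℝ) + 1)⁻¹ • q.2.1‖ ≤ R} :=
      measurableSet_le (by fun_prop) measurable_const
    have m3 : MeasurableSet {q : E d × (E d × ℕ) | q.2.2 = T + 1} :=
      measurableSet_eq_fun (by fun_prop) measurable_const
    exact m1.inter (m2.inter m3)
  induction T with
  | zero =>
    rw [sgdLaw, ae_map_iff (measurable_sgdInit R).aemeasurable (hmeas 0)]
    exact Filter.Eventually.of_forall fun x => by simp [norm_proj_le hR]
  | succ T ih =>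
    have := isProbabilityMeasure_sgdLaw h R σ γ D θ₀ T
    rw [sgdLaw, ae_map_iff (measurable_sgdStep h R γ).aemeasurable (hmeas (T + 1))]
    filter_upwards [Measure.quasiMeasurePreserving_fst.ae ih] with p hp
    obtain ⟨-, h2, h3⟩ := hp
    refine ⟨norm_proj_le hR _, ?_, by simp [sgdStep, h3]⟩
    rw [norm_smul, norm_inv, Real.norm_of_nonneg (by positivity), inv_mul_le_iff₀ (by positivity)]
      at h2 ⊢
    push_cast
    calc _ ≤ ‖p.1.2.1‖ + ‖proj R (p.1.1 - γ • gradient (fun η => l η p.2) p.1.1)‖ := norm_add_le _ _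
      _ ≤ (T + 1) * R + R := add_le_add h2 (norm_proj_le hR _)
      _ = _ := by ring

theorem integrable_risk_sub (h : IsSCLoss μ L l) {D : Measure (E s)} [IsProbabilityMeasure D]
    (hi : ∀ θ, Integrable (l θ) D) {θr : E d} (hr : ‖θr‖ ≤ L / (2 * μ)) (hL : 0 ≤ L)
    {X : Type*} [MeasurableSpace X] {M : Measure X} [IsFiniteMeasure M] {f : X → E d}
    (hf : Measurable f) (hb : ∀ᵐ x ∂M, ‖f x‖ ≤ L / (2 * μ)) :
    Integrable (fun x => risk l D (f x) - risk l D θr) M := by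
  refine Integrable.of_bound (C := L * (L / (2 * μ) + L / (2 * μ)))
    (((measurable_risk h D).comp hf).sub_const _).aestronglyMeasurable ?_
  filter_upwards [hb] with x hx
  have h1 := integral_sub_le h hi hx hr
  rw [probReal_univ, mul_one] at h1
  refine h1.trans ?_
  gcongr
  exact (norm_sub_le _ _).trans (add_le_add hx hr)

theorem integrable_norm_sub_sq {R : ℝ} (θr : E d)
    {X : Type*} [MeasurableSpace X] {M : Measure X} [IsFiniteMeasure M] {f : X → E d}
    (hf : Measurable f) (hb : ∀ᵐ x ∂M, ‖f x‖ ≤ R) :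
    Integrable (fun x => ‖f x - θr‖ ^ 2) M := by
  refine Integrable.of_bound (C := (R + ‖θr‖) ^ 2) (by fun_prop) ?_
  filter_upwards [hb] with x hx
  rw [norm_pow, norm_norm]
  gcongr
  exact (norm_sub_le _ _).trans (by gcongr)

/-- The usual one-step inequality of stochastic gradient descent, in expectation. -/
theorem sgdLaw_descent (h : IsSCLoss μ L l) (hL : 0 < L) (hμ : 0 < μ) (σ : ℝ) {γ : ℝ} (hγ : 0 ≤ γ)
    {D : Measure (E s)} [IsProbabilityMeasure D] (hi : ∀ θ, Integrable (l θ) D) (θ₀ : E d) {θr : E d}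
    (hr : ‖θr‖ ≤ L / (2 * μ)) (T : ℕ) :
    ∫ q, ‖q.1 - θr‖ ^ 2 ∂sgdLaw (L / (2 * μ)) σ γ l D θ₀ (T + 1)
      ≤ ∫ q, ‖q.1 - θr‖ ^ 2 ∂sgdLaw (L / (2 * μ)) σ γ l D θ₀ T
        - 2 * γ * ∫ q, (risk l D q.1 - risk l D θr) ∂sgdLaw (L / (2 * μ)) σ γ l D θ₀ T
        + γ ^ 2 * L ^ 2 := by
  have hR : 0 < L / (2 * μ) := by positivity
  set R := L / (2 * μ) with hRdef
  set M := sgdLaw R σ γ l D θ₀ T with hM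
  have : IsProbabilityMeasure M := isProbabilityMeasure_sgdLaw h R σ γ D θ₀ T
  have hstep := measurable_sgdStep h R γ (s := s)
  have hinv : ∀ᵐ q ∂M, ‖q.1‖ ≤ R := (sgdLaw_invariant h hR.le σ γ D θ₀ T).mono fun q hq => hq.1
  have hinvN : ∀ᵐ p ∂(M.prod D), ‖p.1.1‖ ≤ R := Measure.quasiMeasurePreserving_fst.ae hinv
  rw [sgdLaw, integral_map hstep.aemeasurable (by fun_prop)]
  have i0 : Integrable (fun p : (E d × (E d × ℕ)) × E s => ‖(sgdStep R γ l p).1 - θr‖ ^ 2)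
      (M.prod D) :=
    integrable_norm_sub_sq θr hstep.fst (Filter.Eventually.of_forall fun p => norm_proj_le hR.le _)
  have i1 : Integrable (fun p : (E d × (E d × ℕ)) × E s => ‖p.1.1 - θr‖ ^ 2) (M.prod D) :=
    integrable_norm_sub_sq θr (by fun_prop) hinvN
  have i2 : Integrable (fun p : (E d × (E d × ℕ)) × E s => l p.1.1 p.2 - l θr p.2) (M.prod D) := by
    have m1 : Measurable (fun p : (E d × (E d × ℕ)) × E s => l p.1.1 p.2) :=
      h.measurable.comp ((measurable_fst.comp measurable_fst).prodMk measurable_snd)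
    have m2 : Measurable (fun p : (E d × (E d × ℕ)) × E s => l θr p.2) :=
      h.measurable.comp (measurable_const.prodMk measurable_snd)
    refine Integrable.of_bound (C := L * (R + R)) (m1.sub m2).aestronglyMeasurable ?_
    filter_upwards [hinvN] with p hp
    refine (h.lipschitz p.2 _ _ hp hr).trans ?_
    gcongr
    exact (norm_sub_le _ _).trans (add_le_add hp hr)
  have key : ∀ᵐ p ∂(M.prod D), ‖(sgdStep R γ l p).1 - θr‖ ^ 2
      ≤ ‖p.1.1 - θr‖ ^ 2 - 2 * γ * (l p.1.1 p.2 - l θr p.2) + γ ^ 2 * L ^ 2 := by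
    filter_upwards [hinvN] with p hp
    set g := gradient (fun η => l η p.2) p.1.1 with hg
    have h1 : ‖(sgdStep R γ l p).1 - θr‖ ≤ ‖p.1.1 - γ • g - θr‖ := norm_proj_sub_le hR.le _ hr
    have h2 : ‖p.1.1 - γ • g - θr‖ ^ 2
        = ‖p.1.1 - θr‖ ^ 2 + 2 * γ * inner ℝ g (θr - p.1.1) + γ ^ 2 * ‖g‖ ^ 2 := by
      rw [show p.1.1 - γ • g - θr = (p.1.1 - θr) - γ • g by abel, @norm_sub_sq_real,
        real_inner_smul_right, real_inner_comm, norm_smul, mul_pow, Real.norm_eq_abs, sq_abs,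
        ← neg_sub p.1.1 θr, inner_neg_right]
      ring
    have h3 := h.strongly_convex p.2 p.1.1 θr hp hr
    have h4 : ‖g‖ ≤ L := norm_gradient_le h hL.le hR p.2 hp
    have h5 : 0 ≤ μ / 2 * ‖θr - p.1.1‖ ^ 2 := by positivity
    calc ‖(sgdStep R γ l p).1 - θr‖ ^ 2 ≤ ‖p.1.1 - γ • g - θr‖ ^ 2 := by gcongr
      _ = ‖p.1.1 - θr‖ ^ 2 + 2 * γ * inner ℝ g (θr - p.1.1) + γ ^ 2 * ‖g‖ ^ 2 := h2
      _ ≤ ‖p.1.1 - θr‖ ^ 2 + 2 * γ * (l θr p.2 - l p.1.1 p.2) + γ ^ 2 * L ^ 2 := by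
        gcongr
        linarith
      _ = _ := by ring
  have hint := integral_mono_ae i0
    ((i1.sub (i2.const_mul (2 * γ))).add (integrable_const (γ ^ 2 * L ^ 2))) key
  simp only [Pi.add_apply, Pi.sub_apply] at hint
  have i3 : Integrable (fun p : (E d × (E d × ℕ)) × E s =>
      ‖p.1.1 - θr‖ ^ 2 - 2 * γ * (l p.1.1 p.2 - l θr p.2)) (M.prod D) :=
    i1.sub (i2.const_mul (2 * γ))
  rw [integral_add i3 (integrable_const _), integral_sub i1 (i2.const_mul (2 * γ)),
    integral_const_mul, integral_const, probReal_univ,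
    one_smul] at hint
  have e1 : ∫ p, ‖p.1.1 - θr‖ ^ 2 ∂(M.prod D) = ∫ q, ‖q.1 - θr‖ ^ 2 ∂M := by
    rw [integral_prod _ i1]
    simp
  have e2 : ∫ p, (l p.1.1 p.2 - l θr p.2) ∂(M.prod D) = ∫ q, (risk l D q.1 - risk l D θr) ∂M := by
    rw [integral_prod _ i2]
    refine integral_congr_ae (Filter.Eventually.of_forall fun q => ?_)
    exact integral_sub (hi q.1) (hi θr)
  rw [e1, e2] at hint
  exact hint

/-- With `N = T + 1` iterates, `N` times the excess risk of their average: appending an iterate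
increases it at most by the excess risk of that iterate, by convexity. -/
theorem sgdLaw_average (h : IsSCLoss μ L l) (hL : 0 < L) (hμ : 0 < μ) (σ γ : ℝ)
    {D : Measure (E s)} [IsProbabilityMeasure D] (hi : ∀ θ, Integrable (l θ) D) (θ₀ : E d) {θr : E d}
    (hr : ‖θr‖ ≤ L / (2 * μ)) (T : ℕ) :
    ∫ q, ((T + 1 : ℕ) + 1) * (risk l D ((((T + 1 : ℕ) : ℝ) + 1)⁻¹ • q.2.1) - risk l D θr)
        ∂sgdLaw (L / (2 * μ)) σ γ l D θ₀ (T + 1)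
      ≤ ∫ q, ((T : ℝ) + 1) * (risk l D (((T : ℝ) + 1)⁻¹ • q.2.1) - risk l D θr)
          ∂sgdLaw (L / (2 * μ)) σ γ l D θ₀ T
        + ∫ q, (risk l D q.1 - risk l D θr) ∂sgdLaw (L / (2 * μ)) σ γ l D θ₀ (T + 1) := by
  have hR : 0 < L / (2 * μ) := by positivity
  set R := L / (2 * μ) with hRdef
  set M := sgdLaw R σ γ l D θ₀ T with hM
  have : IsProbabilityMeasure M := isProbabilityMeasure_sgdLaw h R σ γ D θ₀ T
  have hstep := measurable_sgdStep h R γ (s := s)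
  have hinv := sgdLaw_invariant h hR.le σ γ D θ₀ T
  have hinvN : ∀ᵐ p ∂(M.prod D), ‖((T : ℝ) + 1)⁻¹ • p.1.2.1‖ ≤ R :=
    Measure.quasiMeasurePreserving_fst.ae (hinv.mono fun q hq => hq.2.1)
  have hrm := measurable_risk h D
  have m1 : Measurable (fun q : E d × (E d × ℕ) =>
      ((T + 1 : ℕ) + 1 : ℝ) * (risk l D ((((T + 1 : ℕ) : ℝ) + 1)⁻¹ • q.2.1) - risk l D θr)) :=
    ((hrm.comp (by fun_prop)).sub_const _).const_mul _
  have m2 : Measurable (fun q : E d × (E d × ℕ) => risk l D q.1 - risk l D θr) :=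
    (hrm.comp measurable_fst).sub_const _
  rw [sgdLaw, integral_map hstep.aemeasurable m1.aestronglyMeasurable,
    integral_map hstep.aemeasurable m2.aestronglyMeasurable]
  have i1 : Integrable (fun p : (E d × (E d × ℕ)) × E s =>
      risk l D (((T : ℝ) + 1)⁻¹ • p.1.2.1) - risk l D θr) (M.prod D) :=
    integrable_risk_sub h hi hr hL.le (by fun_prop) hinvN
  have i2 : Integrable (fun p : (E d × (E d × ℕ)) × E s =>
      risk l D (sgdStep R γ l p).1 - risk l D θr) (M.prod D) :=
    integrable_risk_sub h hi hr hL.le hstep.fst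
      (Filter.Eventually.of_forall fun p => norm_proj_le hR.le _)
  have hcomb : ∀ p : (E d × (E d × ℕ)) × E s,
      (((T + 1 : ℕ) : ℝ) + 1)⁻¹ • (sgdStep R γ l p).2.1
        = (((T : ℝ) + 1) / ((T : ℝ) + 2)) • (((T : ℝ) + 1)⁻¹ • p.1.2.1)
          + (1 / ((T : ℝ) + 2)) • (sgdStep R γ l p).1 := by
    intro p
    simp only [sgdStep, smul_add, smul_smul]
    push_cast
    congr 2 <;> · field_simp; try ring
  have key : ∀ᵐ p ∂(M.prod D),
      ((T + 1 : ℕ) + 1) * (risk l D ((((T + 1 : ℕ) : ℝ) + 1)⁻¹ • (sgdStep R γ l p).2.1) - risk l D θr)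
      ≤ ((T : ℝ) + 1) * (risk l D (((T : ℝ) + 1)⁻¹ • p.1.2.1) - risk l D θr)
        + (risk l D (sgdStep R γ l p).1 - risk l D θr) := by
    filter_upwards [hinvN] with p hp
    have h1 := risk_segment_le (a := ((T : ℝ) + 1) / ((T : ℝ) + 2)) (b := 1 / ((T : ℝ) + 2)) h hi hp
      (show ‖(sgdStep R γ l p).1‖ ≤ R from norm_proj_le hR.le _) (by positivity) (by positivity)
      (by field_simp; ring)
    rw [hcomb p]
    have h2 : ∀ z : ℝ, 0 ≤ ((T : ℝ) + 1) / ((T : ℝ) + 2) * (1 / ((T : ℝ) + 2)) * (μ / 2 * z ^ 2) :=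
      fun z => by positivity
    have h3 := (le_add_of_nonneg_right (h2 _)).trans h1
    have h4 := mul_le_mul_of_nonneg_left h3 (show (0 : ℝ) ≤ (T : ℝ) + 2 by positivity)
    rw [mul_add, ← mul_assoc, ← mul_assoc, mul_div_cancel₀ _ (by positivity),
      mul_div_cancel₀ _ (by positivity)] at h4
    push_cast
    linarith
  have i0 : Integrable (fun p : (E d × (E d × ℕ)) × E s => ((T + 1 : ℕ) + 1 : ℝ) *
      (risk l D ((((T + 1 : ℕ) : ℝ) + 1)⁻¹ • (sgdStep R γ l p).2.1) - risk l D θr)) (M.prod D) := by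
    refine (integrable_risk_sub h hi hr hL.le ?_ ?_).const_mul _
    · exact hstep.snd.fst.const_smul (((T + 1 : ℕ) : ℝ) + 1)⁻¹
    · have h1 := sgdLaw_invariant h hR.le σ γ D θ₀ (T + 1)
      rw [sgdLaw] at h1
      exact (ae_of_ae_map hstep.aemeasurable h1).mono fun p hp => hp.2.1
  have hint := integral_mono_ae i0 ((i1.const_mul _).add i2) key
  simp only [Pi.add_apply] at hint
  rw [integral_add (i1.const_mul _) i2] at hint
  refine hint.trans (le_of_eq ?_)
  congr 1
  rw [integral_prod _ (i1.const_mul _)]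
  simp

/-- The descent inequality summed over `T + 1` iterates; the last squared distance, produced by one
further step, is kept on the left for the induction. -/
theorem sgdLaw_regret (h : IsSCLoss μ L l) (hL : 0 < L) (hμ : 0 < μ) (σ : ℝ) {γ : ℝ} (hγ : 0 ≤ γ)
    {D : Measure (E s)} [IsProbabilityMeasure D] (hi : ∀ θ, Integrable (l θ) D) (θ₀ : E d) {θr : E d}
    (hr : ‖θr‖ ≤ L / (2 * μ)) (T : ℕ) :
    2 * γ * ∫ q, ((T : ℝ) + 1) * (risk l D (((T : ℝ) + 1)⁻¹ • q.2.1) - risk l D θr)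
        ∂sgdLaw (L / (2 * μ)) σ γ l D θ₀ T
      + ∫ q, ‖q.1 - θr‖ ^ 2 ∂sgdLaw (L / (2 * μ)) σ γ l D θ₀ (T + 1)
      ≤ ‖θ₀ - θr‖ ^ 2 + d * σ ^ 2 + ((T : ℝ) + 1) * (γ ^ 2 * L ^ 2) := by
  have hR : 0 ≤ L / (2 * μ) := by positivity
  induction T with
  | zero =>
    have h1 := sgdLaw_descent h hL hμ σ hγ hi θ₀ hr 0
    have h2 : ∫ q, (((0 : ℕ) : ℝ) + 1) * (risk l D ((((0 : ℕ) : ℝ) + 1)⁻¹ • q.2.1) - risk l D θr)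
        ∂sgdLaw (L / (2 * μ)) σ γ l D θ₀ 0
        = ∫ q, (risk l D q.1 - risk l D θr) ∂sgdLaw (L / (2 * μ)) σ γ l D θ₀ 0 := by
      have hrm := measurable_risk h D
      rw [sgdLaw, integral_map (measurable_sgdInit _).aemeasurable, integral_map
        (measurable_sgdInit _).aemeasurable]
      · simp
      · exact ((hrm.comp measurable_fst).sub_const _).aestronglyMeasurable
      · exact (((hrm.comp (by fun_prop)).sub_const _).const_mul _).aestronglyMeasurable
    have h3 : ∫ q, ‖q.1 - θr‖ ^ 2 ∂sgdLaw (L / (2 * μ)) σ γ l D θ₀ 0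
        ≤ ‖θ₀ - θr‖ ^ 2 + d * σ ^ 2 := by
      obtain ⟨hint, heq⟩ := integral_norm_add_smul_sq (θ₀ - θr) σ
      rw [sgdLaw, integral_map (measurable_sgdInit _).aemeasurable (by fun_prop),
        integral_map (by fun_prop), ← heq]
      · refine integral_mono_of_nonneg (Filter.Eventually.of_forall fun z => by positivity) hint
          (Filter.Eventually.of_forall fun z => ?_)
        have := norm_proj_sub_le hR (θ₀ + σ • z) hr
        rw [show θ₀ + σ • z - θr = θ₀ - θr + σ • z by abel] at this
        simp only
        gcongr
      · have := measurable_proj (d := d) (L / (2 * μ))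
        exact Measurable.aestronglyMeasurable (by fun_prop)
    rw [h2]
    push_cast
    linarith
  | succ T ih =>
    have h1 := sgdLaw_descent h hL hμ σ hγ hi θ₀ hr (T + 1)
    have h2 := mul_le_mul_of_nonneg_left (sgdLaw_average h hL hμ σ γ hi θ₀ hr T)
      (show 0 ≤ 2 * γ by positivity)
    push_cast at h2 ⊢
    linarith

theorem reaches_noiseFineTune (h : IsSCLoss μ L l) (hL : 0 < L) (hμ : 0 < μ) (σ : ℝ) {e : ℝ}
    (he : 0 < e) {D : Measure (E s)} [IsProbabilityMeasure D] (hi : ∀ θ, Integrable (l θ) D)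
    (θ₀ : E d) {θr : E d} (hr : ‖θr‖ ≤ L / (2 * μ)) {T : ℕ}
    (hT : (‖θ₀ - θr‖ ^ 2 + d * σ ^ 2) * L ^ 2 / e ^ 2 ≤ (T : ℝ) + 1) :
    (noiseFineTune d (L / (2 * μ)) σ (e / L ^ 2)).Reaches l D θ₀ θr e T := by
  have hR : 0 ≤ L / (2 * μ) := by positivity
  have hrm := measurable_risk h D
  have hM := isProbabilityMeasure_sgdLaw h (L / (2 * μ)) σ (e / L ^ 2) D θ₀ T
  have hinv := sgdLaw_invariant h hR σ (e / L ^ 2) D θ₀ T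
  rw [Algorithm.Reaches, outputLaw_noiseFineTune h]
  have hav : ∀ᵐ q ∂sgdLaw (L / (2 * μ)) σ (e / L ^ 2) l D θ₀ T,
      ‖(q.2.2 : ℝ)⁻¹ • q.2.1‖ ≤ L / (2 * μ) := by
    filter_upwards [hinv] with q hq
    rw [hq.2.2]
    push_cast
    exact hq.2.1
  have hint := integrable_risk_sub h hi hr hL.le (measurable_average (d := d)) hav
  constructor
  · rw [integrable_map_measure hrm.aestronglyMeasurable measurable_average.aemeasurable]
    refine (hint.add (integrable_const (risk l D θr))).congr (Filter.Eventually.of_forall fun q => ?_)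
    simp
  · rw [integral_map measurable_average.aemeasurable (hrm.sub_const _).aestronglyMeasurable]
    have h1 := sgdLaw_regret h hL hμ σ (γ := e / L ^ 2) (by positivity) hi θ₀ hr T
    rw [integral_const_mul] at h1
    have h2 : ∫ q, (risk l D ((q.2.2 : ℝ)⁻¹ • q.2.1) - risk l D θr)
          ∂sgdLaw (L / (2 * μ)) σ (e / L ^ 2) l D θ₀ T
        = ∫ q, (risk l D (((T : ℝ) + 1)⁻¹ • q.2.1) - risk l D θr)
          ∂sgdLaw (L / (2 * μ)) σ (e / L ^ 2) l D θ₀ T := by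
      refine integral_congr_ae ?_
      filter_upwards [hinv] with q hq
      rw [hq.2.2]
      push_cast
      rfl
    rw [h2]
    set I := ∫ q, (risk l D (((T : ℝ) + 1)⁻¹ • q.2.1) - risk l D θr)
          ∂sgdLaw (L / (2 * μ)) σ (e / L ^ 2) l D θ₀ T
    have h3 : 0 ≤ ∫ q, ‖q.1 - θr‖ ^ 2 ∂sgdLaw (L / (2 * μ)) σ (e / L ^ 2) l D θ₀ (T + 1) :=
      integral_nonneg fun q => by positivity
    rw [div_le_iff₀ (by positivity)] at hT
    have h4 : 2 * (e / L ^ 2) * ((T + 1) * I) * L ^ 2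
        ≤ (‖θ₀ - θr‖ ^ 2 + d * σ ^ 2 + (T + 1) * ((e / L ^ 2) ^ 2 * L ^ 2)) * L ^ 2 := by
      gcongr
      linarith
    have e1 : 2 * (e / L ^ 2) * ((T + 1) * I) * L ^ 2 = 2 * e * (T + 1) * I := by field_simp
    have e2 : (‖θ₀ - θr‖ ^ 2 + d * σ ^ 2 + (T + 1) * ((e / L ^ 2) ^ 2 * L ^ 2)) * L ^ 2
        = (‖θ₀ - θr‖ ^ 2 + d * σ ^ 2) * L ^ 2 + (T + 1) * e ^ 2 := by field_simp
    rw [e1, e2] at h4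
    have hp : 0 < 2 * e * ((T : ℝ) + 1) := by positivity
    refine le_of_mul_le_mul_left ?_ hp
    linarith

/-- `T` iterations give `T + 1` iterates to average, so one fewer than `⌈x⌉` iterations are enough, and
none when `x ≤ 1` (also when `x ≤ 0`, where the subtraction truncates). -/
theorem time_noiseFineTune_le (h : IsSCLoss μ L l) (hL : 0 < L) (hμ : 0 < μ) (σ : ℝ) {e : ℝ}
    (he : 0 < e) {D : Measure (E s)} [IsProbabilityMeasure D] (hi : ∀ θ, Integrable (l θ) D)
    (θ₀ : E d) {θr : E d} (hr : ‖θr‖ ≤ L / (2 * μ)) {x : ℝ}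
    (hx : (‖θ₀ - θr‖ ^ 2 + d * σ ^ 2) * L ^ 2 / e ^ 2 ≤ x) :
    (noiseFineTune d (L / (2 * μ)) σ (e / L ^ 2)).time l D θ₀ θr e ≤ ((⌈x⌉₊ - 1 : ℕ) : ℕ∞) := by
  refine iInf₂_le _ fun T hT => reaches_noiseFineTune h hL hμ σ he hi θ₀ hr ?_
  have h1 : (⌈x⌉₊ : ℝ) ≤ (T : ℝ) + 1 := by
    exact_mod_cast (by omega : ⌈x⌉₊ ≤ T + 1)
  linarith [Nat.le_ceil x]

end Convergence

/-! ### Privacy of noise and fine-tune -/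

section Privacy

theorem map_le_of_le {X Y : Type*} [MeasurableSpace X] [MeasurableSpace Y] {M M' : Measure X}
    {a b : ℝ≥0∞} (hM : ∀ S, MeasurableSet S → M S ≤ a * M' S + b) {f : X → Y} (hf : Measurable f)
    (S : Set Y) (hS : MeasurableSet S) : M.map f S ≤ a * M'.map f S + b := by
  rw [Measure.map_apply hf hS, Measure.map_apply hf hS]
  exact hM _ (hf hS)

theorem prod_le_of_le {X Y : Type*} [MeasurableSpace X] [MeasurableSpace Y] {M M' : Measure X}
    [SFinite M] [SFinite M'] (D : Measure Y) [IsProbabilityMeasure D] {a b : ℝ≥0∞}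
    (hM : ∀ S, MeasurableSet S → M S ≤ a * M' S + b) (S : Set (X × Y)) (hS : MeasurableSet S) :
    M.prod D S ≤ a * M'.prod D S + b := by
  rw [Measure.prod_apply_symm hS, Measure.prod_apply_symm hS,
    ← lintegral_const_mul _ (measurable_measure_prodMk_right hS)]
  calc _ ≤ ∫⁻ y, (a * M' ((fun x => (x, y)) ⁻¹' S) + b) ∂D :=
        lintegral_mono fun y => hM _ (measurable_prodMk_right hS)
    _ = _ := by
        rw [lintegral_add_right _ measurable_const]
        simp

/-- Post-processing: the fine-tuning steps only use the noisy initial point and the retained data,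
so they preserve indistinguishability. -/
theorem outputLaw_noiseFineTune_le {d s : ℕ} {μ L : ℝ} {l : E d → E s → ℝ} (h : IsSCLoss μ L l)
    (R σ γ : ℝ) (D : Measure (E s)) [IsProbabilityMeasure D] {x y : E d} {a b : ℝ≥0∞}
    (hxy : ∀ S, MeasurableSet S → (stdGaussian (E d)).map (fun z => x + σ • z) S
      ≤ a * (stdGaussian (E d)).map (fun z => y + σ • z) S + b)
    (T : ℕ) (S : Set (E d)) (hS : MeasurableSet S) :
    (noiseFineTune d R σ γ).outputLaw l D x T S
      ≤ a * (noiseFineTune d R σ γ).outputLaw l D y T S + b := by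
  have hlaw : ∀ T : ℕ, ∀ S, MeasurableSet S →
      sgdLaw R σ γ l D x T S ≤ a * sgdLaw R σ γ l D y T S + b := by
    intro T
    induction T with
    | zero => exact map_le_of_le hxy (measurable_sgdInit R)
    | succ T ih =>
      have := isProbabilityMeasure_sgdLaw h R σ γ D x T
      have := isProbabilityMeasure_sgdLaw h R σ γ D y T
      exact map_le_of_le (prod_le_of_le D ih) (measurable_sgdStep h R γ)
  rw [outputLaw_noiseFineTune h, outputLaw_noiseFineTune h]
  exact map_le_of_le (hlaw T) measurable_average S hS

theorem kappa_pos {ε δ : ℝ} (hε : 0 < ε) (hδ : 0 < δ) (hδ1 : δ < 1) : 0 < kappa ε δ := by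
  have : 0 < Real.log (1.25 / δ) := Real.log_pos ((one_lt_div hδ).2 (by linarith))
  unfold kappa
  positivity

theorem isUnlearning_noiseFineTune {d s : ℕ} {μ L : ℝ} (hμ : 0 < μ) (hL : 0 < L) {rf : ℝ}
    (h0 : 0 ≤ rf) (h1 : rf < 1) {ε δ : ℝ} (hε : 0 < ε) (hδ : 0 < δ) (hδ1 : δ < 1) {c : ℝ}
    (hc : 8 + 8 * ε ≤ c) (γ : ℝ) :
    (noiseFineTune d (L / (2 * μ)) (c * kappa ε δ * (rf / (1 - rf)) * (L / μ)) γ).IsUnlearning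
      s μ L rf ε δ := by
  intro l h Dr Df Df' _ _ _ θ θ' hm hm' T S hS
  have hdist := norm_minimizer_sub_le h hμ hL h0 h1 hm hm'
  refine outputLaw_noiseFineTune_le h _ _ _ Dr (fun S hS => ?_) T S hS
  rcases h0.eq_or_lt with rfl | hrf
  · -- Without forgotten data the two minimizers coincide, and no noise is needed.
    have : θ = θ' := by
      rw [← sub_eq_zero, ← norm_le_zero_iff]
      simpa using hdist
    subst this
    refine le_add_right (le_mul_of_one_le_left zero_le ?_)
    rw [ENNReal.one_le_ofReal]
    exact Real.one_le_exp hε.le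
  have hκ := kappa_pos hε hδ hδ1
  have h1' : 0 < 1 - rf := by linarith
  have hcpos : 0 < c := by linarith
  -- A Gaussian tail at `τ` has probability at most `δ / 1.25`, and `τ² ≥ 2 / 5` as `δ < 1`.
  set τ := Real.sqrt (2 * Real.log (1.25 / δ)) with hτ
  have hlog : 1 / 5 ≤ Real.log (1.25 / δ) := by
    have e1 : (1.25 : ℝ) ≤ 1.25 / δ := by
      rw [le_div_iff₀ hδ]; linarith
    have e2 := Real.one_sub_inv_le_log_of_pos (show (0 : ℝ) < 1.25 by norm_num)
    have e3 := Real.log_le_log (by norm_num) e1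
    norm_num at e2 e3 ⊢
    linarith
  have hτ2 : τ ^ 2 = 2 * Real.log (1.25 / δ) := Real.sq_sqrt (by linarith)
  have hτpos : 0 < τ := Real.sqrt_pos.2 (by linarith)
  have hκτ : kappa ε δ = τ / ε := by rw [kappa, ← hτ]; ring
  set σ := c * kappa ε δ * (rf / (1 - rf)) * (L / μ) with hσ
  have hσpos : 0 < σ := by positivity
  set η := ‖θ - θ'‖ / σ with hη
  have hη0 : 0 ≤ η := by positivity
  have hη1 : η ≤ 4 * ε / (c * τ) := by
    rw [hη, div_le_div_iff₀ hσpos (by positivity)]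
    have e1 : 4 * ε * σ = (c * τ) * (4 * (rf / (1 - rf)) * L / μ) := by
      rw [hσ, hκτ]; field_simp
    rw [e1, mul_comm]
    gcongr
    refine hdist.trans ?_
    gcongr
    rw [le_div_iff₀ h1']
    nlinarith
  refine gaussian_mechanism θ θ' hσpos hτpos.le hε.le ?_ ?_ hS
  · have e1 : η * (τ + η / 2) ≤ 4 * ε / (c * τ) * (τ + 4 * ε / (c * τ) / 2) := by gcongr
    refine e1.trans ?_
    have e2 : 4 * ε / (c * τ) * (τ + 4 * ε / (c * τ) / 2)
        = (4 * c * τ ^ 2 + 8 * ε) * ε / (c ^ 2 * τ ^ 2) := by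
      field_simp
      ring
    rw [e2, div_le_iff₀ (by positivity), mul_comm]
    refine mul_le_mul_of_nonneg_left ?_ hε.le
    have e3 : 2 / 5 ≤ τ ^ 2 := by rw [hτ2]; linarith
    have e4 : 0 ≤ c * (c - 8 - 8 * ε) := mul_nonneg hcpos.le (by linarith)
    have e5 : 20 * ε ≤ c ^ 2 - 4 * c := by nlinarith
    have e6 : 0 ≤ c ^ 2 - 4 * c := by linarith
    nlinarith [mul_le_mul_of_nonneg_left e3 e6]
  · rw [hτ2, mul_div_cancel_left₀ _ two_ne_zero, Real.exp_neg, Real.exp_log (by positivity),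
      inv_div, div_le_iff₀ (by norm_num)]
    linarith

end Privacy

/-! ### Lower bound for retraining -/

section Affinity

theorem two_mul_le_add_of_mul_self_le {c x y : ℝ≥0∞} (h : c * c ≤ x * y) : 2 * c ≤ x + y := by
  rcases eq_or_ne x ⊤ with rfl | hx
  · simp
  rcases eq_or_ne y ⊤ with rfl | hy
  · simp
  have hc : c ≠ ⊤ := by
    rintro rfl
    rw [ENNReal.top_mul_top, top_le_iff] at h
    exact ENNReal.mul_ne_top hx hy h
  lift x to NNReal using hx
  lift y to NNReal using hy
  lift c to NNReal using hc
  norm_cast at h ⊢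
  rw [← NNReal.coe_le_coe] at h ⊢
  push_cast at h ⊢
  refine le_of_sq_le_sq ?_ (by positivity)
  nlinarith [sq_nonneg ((x : ℝ) - y)]

/-- Cauchy–Schwarz for `√u` and `√v`. -/
theorem le_lintegral_mul_lintegral {X : Type*} [MeasurableSpace X] (ν : Measure X)
    [IsProbabilityMeasure ν] {u v : X → ℝ≥0∞} (hu : Measurable u) (hv : Measurable v) {c : ℝ≥0∞}
    (huv : ∀ x, c ≤ u x * v x) : c ≤ (∫⁻ x, u x ∂ν) * ∫⁻ x, v x ∂ν := by
  have h1 := ENNReal.lintegral_mul_le_Lp_mul_Lq ν Real.HolderConjugate.two_two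
    (hu.pow_const (1 / 2 : ℝ)).aemeasurable (hv.pow_const (1 / 2 : ℝ)).aemeasurable
  simp only [Pi.mul_apply, ← ENNReal.rpow_mul] at h1
  norm_num at h1
  have h2 : c ^ (1 / 2 : ℝ) ≤ ∫⁻ x, u x ^ (1 / 2 : ℝ) * v x ^ (1 / 2 : ℝ) ∂ν := by
    calc c ^ (1 / 2 : ℝ) = ∫⁻ _, c ^ (1 / 2 : ℝ) ∂ν := by simp
      _ ≤ _ := lintegral_mono fun x => by
          rw [← ENNReal.mul_rpow_of_nonneg _ _ (by norm_num)]
          exact ENNReal.rpow_le_rpow (huv x) (by norm_num)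
  have h3 := h2.trans h1
  rw [← ENNReal.mul_rpow_of_nonneg _ _ (by norm_num)] at h3
  exact (ENNReal.rpow_le_rpow_iff (by norm_num)).1 h3

/-- One step of the affinity bound: the affinity of the laws `(p, q)` and `(q, p)` on two points is
`2 √(p q)`. -/
theorem mixture_mul_mixture_ge {p q c u₁ u₂ v₁ v₂ : ℝ≥0∞} (h1 : c ≤ u₁ * v₁) (h2 : c ≤ u₂ * v₂) :
    4 * (p * q) * c ≤ (p * u₁ + q * u₂) * (q * v₁ + p * v₂) := by
  have h3 : 2 * (p * q * c) ≤ p * u₁ * (p * v₂) + q * u₂ * (q * v₁) := by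
    refine two_mul_le_add_of_mul_self_le ?_
    calc p * q * c * (p * q * c) = p * q * (p * q) * (c * c) := by ring
      _ ≤ p * q * (p * q) * (u₁ * v₁ * (u₂ * v₂)) := by gcongr
      _ = _ := by ring
  calc 4 * (p * q) * c = p * q * c + p * q * c + 2 * (p * q * c) := by ring
    _ ≤ p * q * (u₁ * v₁) + p * q * (u₂ * v₂) + (p * u₁ * (p * v₂) + q * u₂ * (q * v₁)) := by gcongr
    _ = _ := by ring

end Affinity

section SignLoss

variable {d s : ℕ} {μ L : ℝ}

/-- The loss `μ / 2 ‖θ‖² + χ(ξ) (L / 2) ⟪w, θ⟫`; for `χ` with values `±1`, a gradient reveals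
exactly the sign `χ(ξ)`. -/
noncomputable def signLoss (μ L : ℝ) (w : E d) (χ : E s → ℝ) (θ : E d) (ξ : E s) : ℝ :=
  μ / 2 * ‖θ‖ ^ 2 + χ ξ * (L / 2) * inner ℝ w θ

theorem hasGradientAt_signLoss (μ L : ℝ) (w : E d) (χ : E s → ℝ) (ξ : E s) (θ : E d) :
    HasGradientAt (fun η => signLoss μ L w χ η ξ) (μ • θ + (χ ξ * (L / 2)) • w) θ := by
  have h1 : HasFDerivAt (fun η : E d => ‖η‖ ^ 2) (2 • innerSL ℝ θ) θ :=
    (hasStrictFDerivAt_norm_sq θ).hasFDerivAt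
  have h2 : HasFDerivAt (fun η : E d => inner ℝ w η) (innerSL ℝ w) θ := (innerSL ℝ w).hasFDerivAt
  have h3 : (InnerProductSpace.toDual ℝ (E d)) (μ • θ + (χ ξ * (L / 2)) • w)
      = (μ / 2) • (2 • innerSL ℝ θ) + (χ ξ * (L / 2)) • innerSL ℝ w := by
    ext v
    simp
    ring
  rw [hasGradientAt_iff_hasFDerivAt, h3]
  exact (h1.const_mul (μ / 2)).add (h2.const_mul (χ ξ * (L / 2)))

theorem gradient_signLoss (w : E d) (χ : E s → ℝ) (ξ : E s) (θ : E d) :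
    gradient (fun η => signLoss μ L w χ η ξ) θ = μ • θ + (χ ξ * (L / 2)) • w :=
  (hasGradientAt_signLoss μ L w χ ξ θ).gradient

theorem isSCLoss_signLoss (hμ : 0 < μ) (hL : 0 < L) {w : E d} (hw : ‖w‖ = 1) {χ : E s → ℝ}
    (hχ : Measurable χ) (hχ1 : ∀ ξ, |χ ξ| = 1) : IsSCLoss μ L (signLoss μ L w χ) where
  measurable := by
    unfold signLoss
    have h1 : Measurable (fun p : E d × E s => χ p.2) := hχ.comp measurable_snd
    have h2 : Measurable (fun p : E d × E s => inner ℝ w p.1) := by fun_prop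
    have h3 : Measurable (fun p : E d × E s => μ / 2 * ‖p.1‖ ^ 2) := by fun_prop
    exact h3.add ((h1.mul_const _).mul h2)
  differentiable ξ θ := (hasGradientAt_signLoss μ L w χ ξ θ).differentiableAt
  lipschitz ξ x y hx hy := by
    have e1 : signLoss μ L w χ x ξ - signLoss μ L w χ y ξ
        = inner ℝ ((μ / 2) • (x + y) + (χ ξ * (L / 2)) • w) (x - y) := by
      simp only [signLoss, inner_add_left, real_inner_smul_left, inner_sub_right,
        real_inner_self_eq_norm_sq, real_inner_comm x y]
      ring
    rw [e1]
    refine (abs_real_inner_le_norm _ _).trans ?_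
    gcongr
    calc _ ≤ ‖(μ / 2) • (x + y)‖ + ‖(χ ξ * (L / 2)) • w‖ := norm_add_le _ _
      _ = μ / 2 * ‖x + y‖ + L / 2 := by
          rw [norm_smul, norm_smul, hw, Real.norm_of_nonneg (by positivity), Real.norm_eq_abs,
            abs_mul, hχ1, abs_of_pos (by positivity : 0 < L / 2)]
          ring
      _ ≤ μ / 2 * (L / (2 * μ) + L / (2 * μ)) + L / 2 := by
          gcongr
          exact (norm_add_le _ _).trans (add_le_add hx hy)
      _ = L := by field_simp; ring
  strongly_convex ξ x y _ _ := by
    rw [gradient_signLoss]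
    refine le_of_eq ?_
    rw [@norm_sub_sq_real]
    simp only [signLoss, inner_add_left, real_inner_smul_left, inner_sub_right,
      real_inner_self_eq_norm_sq, real_inner_comm x y]
    ring

theorem risk_signLoss_sub (hμ : 0 < μ) {w : E d} (hw : ‖w‖ = 1) {χ : E s → ℝ} {D : Measure (E s)}
    [IsProbabilityMeasure D] (hi : Integrable χ D) {m : ℝ} (hm : ∫ ξ, χ ξ ∂D = m) (θ : E d) :
    risk (signLoss μ L w χ) D θ - risk (signLoss μ L w χ) D (-(m * (L / (2 * μ))) • w)
      = μ / 2 * ‖θ - (-(m * (L / (2 * μ))) • w)‖ ^ 2 := by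
  have h1 : ∀ θ, risk (signLoss μ L w χ) D θ = μ / 2 * ‖θ‖ ^ 2 + m * (L / 2) * inner ℝ w θ := by
    intro θ
    unfold risk signLoss
    simp_rw [mul_assoc (χ _)]
    rw [integral_add (integrable_const _) (hi.mul_const _), integral_const, integral_mul_const, hm]
    simp [mul_assoc]
  rw [h1, h1, @norm_sub_sq_real]
  simp only [norm_smul, real_inner_smul_right, real_inner_self_eq_norm_sq, hw, real_inner_comm θ w,
    mul_pow, Real.norm_eq_abs, sq_abs]
  field_simp
  ring

theorem isRiskMinimizer_signLoss (hμ : 0 < μ) (hL : 0 < L) {w : E d} (hw : ‖w‖ = 1) {χ : E s → ℝ}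
    {D : Measure (E s)} [IsProbabilityMeasure D] (hi : Integrable χ D) {m : ℝ} (hm1 : |m| ≤ 1)
    (hm : ∫ ξ, χ ξ ∂D = m) :
    IsRiskMinimizer (L / (2 * μ)) (signLoss μ L w χ) D (-(m * (L / (2 * μ))) • w) where
  integrable θ := (integrable_const _).add ((hi.mul_const _).mul_const _)
  norm_le := by
    rw [norm_smul, hw, mul_one, Real.norm_eq_abs, abs_neg, abs_mul,
      abs_of_pos (by positivity : 0 < L / (2 * μ))]
    exact mul_le_of_le_one_left (by positivity) hm1
  lt θ hθ := by
    rw [← sub_pos, risk_signLoss_sub hμ hw hi hm]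
    have := norm_pos_iff.2 (sub_ne_zero.2 hθ)
    positivity

/-- The update of state and seed caused by the sign `t` of the data point. -/
noncomputable def Algorithm.signStep (A : Algorithm d) (μ L : ℝ) (w : E d) (t : ℝ)
    (p : (E d × A.Mem) × A.Seed) : (E d × A.Mem) × A.Seed :=
  (A.update (p.1.1, μ • p.1.1 + (t * (L / 2)) • w, p.1.2, p.2), p.2)

theorem Algorithm.measurable_signStep (A : Algorithm d) (w : E d) (t : ℝ) :
    Measurable (A.signStep μ L w t) := by
  refine Measurable.prodMk (A.measurable_update.comp ?_) measurable_snd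
  exact Measurable.prodMk (by fun_prop) (Measurable.prodMk (by fun_prop) (by fun_prop))

theorem lintegral_stateLaw_signLoss (A : Algorithm d) (hμ : 0 < μ) (hL : 0 < L) {w : E d}
    (hw : ‖w‖ = 1) {χ : E s → ℝ} (hχ : Measurable χ) (hχ1 : ∀ ξ, χ ξ = 1 ∨ χ ξ = -1)
    (D : Measure (E s)) [IsProbabilityMeasure D] (θ₀ : E d) (T : ℕ)
    {f : (E d × A.Mem) × A.Seed → ℝ≥0∞} (hf : Measurable f) :
    ∫⁻ x, f x ∂A.stateLaw (signLoss μ L w χ) D θ₀ (T + 1)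
      = ∫⁻ x, (D {ξ | χ ξ = 1} * f (A.signStep μ L w 1 x)
          + D {ξ | χ ξ = -1} * f (A.signStep μ L w (-1) x))
        ∂A.stateLaw (signLoss μ L w χ) D θ₀ T := by
  have h := isSCLoss_signLoss hμ hL hw hχ
    (fun ξ => by rcases hχ1 ξ with h | h <;> simp [h])
  have := A.isProbabilityMeasure_stateLaw h D θ₀ T
  have hstep := A.measurable_step h
  rw [Algorithm.stateLaw, lintegral_map hf hstep, lintegral_prod _ (by fun_prop)]
  refine lintegral_congr fun x => ?_
  have m1 : MeasurableSet {ξ | χ ξ = 1} := hχ (measurableSet_singleton 1)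
  have m2 : MeasurableSet {ξ | χ ξ = -1} := hχ (measurableSet_singleton (-1))
  have e : ∀ ξ, f (A.step (signLoss μ L w χ) (x, ξ))
      = {ξ | χ ξ = 1}.indicator (fun _ => f (A.signStep μ L w 1 x)) ξ
        + {ξ | χ ξ = -1}.indicator (fun _ => f (A.signStep μ L w (-1) x)) ξ := by
    intro ξ
    simp only [Algorithm.step, gradient_signLoss, Set.indicator, Set.mem_ofPred_eq]
    rcases hχ1 ξ with h | h <;> norm_num [h, Algorithm.signStep]
  simp_rw [e]
  rw [lintegral_add_left (measurable_const.indicator m1), lintegral_indicator m1,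
    lintegral_indicator m2, lintegral_const, lintegral_const]
  simp [mul_comm]

/-- After `T` gradients, the state laws for the signs `χ` and `-χ` have Hellinger affinity at least
`(4 p q) ^ (T / 2)`, where `p` and `q` are the probabilities of the two signs. The affinity enters in
its dual form, an inequality for all pairs of test functions with product bounded below, which
passes through one step of the chain. -/
theorem affinity_stateLaw (A : Algorithm d) (hμ : 0 < μ) (hL : 0 < L) {w : E d}
    (hw : ‖w‖ = 1) {χ : E s → ℝ} (hχ : Measurable χ) (hχ1 : ∀ ξ, χ ξ = 1 ∨ χ ξ = -1)
    (D : Measure (E s)) [IsProbabilityMeasure D] (θ₀ : E d) (T : ℕ)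
    {u v : (E d × A.Mem) × A.Seed → ℝ≥0∞} (hu : Measurable u) (hv : Measurable v) {c : ℝ≥0∞}
    (huv : ∀ x, c ≤ u x * v x) :
    (4 * (D {ξ | χ ξ = 1} * D {ξ | χ ξ = -1})) ^ T * c
      ≤ (∫⁻ x, u x ∂A.stateLaw (signLoss μ L w χ) D θ₀ T)
        * ∫⁻ x, v x ∂A.stateLaw (signLoss μ L w (-χ)) D θ₀ T := by
  induction T generalizing u v c with
  | zero =>
    rw [pow_zero, one_mul]
    have h := isSCLoss_signLoss hμ hL hw hχ
      (fun ξ => by rcases hχ1 ξ with h | h <;> simp [h])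
    have : IsProbabilityMeasure (A.stateLaw (signLoss μ L w χ) D θ₀ 0) :=
      A.isProbabilityMeasure_stateLaw h D θ₀ 0
    exact le_lintegral_mul_lintegral _ hu hv huv
  | succ T ih =>
    have hχ1' : ∀ ξ, (-χ) ξ = 1 ∨ (-χ) ξ = -1 := fun ξ => by
      rcases hχ1 ξ with h | h <;> simp [h]
    have s1 : {ξ | (-χ) ξ = 1} = {ξ | χ ξ = -1} := by
      ext ξ; simp [neg_eq_iff_eq_neg]
    have s2 : {ξ | (-χ) ξ = -1} = {ξ | χ ξ = 1} := by
      ext ξ; simp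
    rw [lintegral_stateLaw_signLoss A hμ hL hw hχ hχ1 D θ₀ T hu,
      lintegral_stateLaw_signLoss A hμ hL hw hχ.neg hχ1' D θ₀ T hv, s1, s2, pow_succ, mul_assoc]
    have k1 := A.measurable_signStep (μ := μ) (L := L) w 1
    have k2 := A.measurable_signStep (μ := μ) (L := L) w (-1)
    exact ih (((hu.comp k1).const_mul _).add ((hu.comp k2).const_mul _))
      (((hv.comp k1).const_mul _).add ((hv.comp k2).const_mul _))
      (fun x => mixture_mul_mixture_ge (huv _) (huv _))

end SignLoss

section LowerBound

variable {d s : ℕ} {μ L : ℝ}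

/-- For a quadratic risk, small excess risk is a small second moment of the distance to the minimizer;
`t` is a shift that the affinity bound leaves free. -/
theorem lintegral_le_of_reaches (A : Algorithm d) {l : E d → E s → ℝ} (h : IsSCLoss μ L l)
    (hμ : 0 < μ) {D : Measure (E s)} [IsProbabilityMeasure D] {θ₀ θr : E d} {e : ℝ} {T : ℕ}
    (hrisk : ∀ θ, risk l D θ - risk l D θr = μ / 2 * ‖θ - θr‖ ^ 2)
    (hA : A.Reaches l D θ₀ θr e T) {t : ℝ} (ht : 0 ≤ t) :
    ∫⁻ p, ENNReal.ofReal (‖A.output p.1 - θr‖ ^ 2 + t) ∂A.stateLaw l D θ₀ T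
      ≤ ENNReal.ofReal (2 * e / μ + t) := by
  have := A.isProbabilityMeasure_stateLaw h D θ₀ T
  have ho : Measurable (fun p : (E d × A.Mem) × A.Seed => A.output p.1) :=
    A.measurable_output.comp measurable_fst
  have hprob : IsProbabilityMeasure (A.outputLaw l D θ₀ T) :=
    Measure.isProbabilityMeasure_map ho.aemeasurable
  obtain ⟨h1, h2⟩ := hA
  have h3 : Integrable (fun θ => ‖θ - θr‖ ^ 2) (A.outputLaw l D θ₀ T) := by
    refine ((h1.sub (integrable_const (risk l D θr))).const_mul (2 / μ)).congr
      (Filter.Eventually.of_forall fun θ => ?_)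
    simp only [Pi.sub_apply]
    rw [hrisk]
    field_simp
  simp_rw [hrisk] at h2
  rw [integral_const_mul] at h2
  have h4 : ∫⁻ p, ENNReal.ofReal (‖A.output p.1 - θr‖ ^ 2 + t) ∂A.stateLaw l D θ₀ T
      = ∫⁻ θ, ENNReal.ofReal (‖θ - θr‖ ^ 2 + t) ∂A.outputLaw l D θ₀ T := by
    rw [Algorithm.outputLaw, lintegral_map (by fun_prop) ho]
  have h5 : Integrable (fun θ => ‖θ - θr‖ ^ 2 + t) (A.outputLaw l D θ₀ T) :=
    h3.add (integrable_const t)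
  rw [h4, ← ofReal_integral_eq_lintegral_ofReal h5
    (Filter.Eventually.of_forall fun θ => by positivity), integral_add h3 (integrable_const t)]
  refine ENNReal.ofReal_le_ofReal ?_
  simp only [integral_const, probReal_univ, one_smul, add_le_add_iff_right]
  rw [le_div_iff₀ hμ]
  linarith

/-- Two-point lower bound: no algorithm can reach a small excess risk after `T` iterations both for
the signs `χ`, of mean `a`, and for `-χ`. -/
theorem excess_ge_of_reaches (A : Algorithm d) (hμ : 0 < μ) (hL : 0 < L) {w : E d} (hw : ‖w‖ = 1)
    {χ : E s → ℝ} (hχ : Measurable χ) (hχ1 : ∀ ξ, χ ξ = 1 ∨ χ ξ = -1) {D : Measure (E s)}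
    [IsProbabilityMeasure D] (θ₀ : E d) {a e : ℝ} (ha1 : a ^ 2 ≤ 1) (he : 0 ≤ e) (T : ℕ)
    (hp : D {ξ | χ ξ = 1} * D {ξ | χ ξ = -1} = ENNReal.ofReal ((1 - a ^ 2) / 4))
    (hi : Integrable χ D) (hm : ∫ ξ, χ ξ ∂D = a)
    (h1 : A.Reaches (signLoss μ L w χ) D θ₀ (-(a * (L / (2 * μ))) • w) e T)
    (h2 : A.Reaches (signLoss μ L w (-χ)) D θ₀ (-(-a * (L / (2 * μ))) • w) e T) :
    L ^ 2 / (8 * μ) * (a ^ 2 * (1 - a ^ 2) ^ T) ≤ e := by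
  have hχabs : ∀ ξ, |χ ξ| = 1 := fun ξ => by rcases hχ1 ξ with h | h <;> simp [h]
  have hm' : ∫ ξ, (-χ) ξ ∂D = -a := by
    simp only [Pi.neg_apply]
    rw [integral_neg, hm]
  set R := L / (2 * μ) with hR
  set α := (1 - a ^ 2) ^ T with hα
  have hα0 : 0 ≤ α := pow_nonneg (by linarith) T
  -- The shift that optimizes the bound.
  set t := a ^ 2 * R ^ 2 * α with ht
  have ht0 : 0 ≤ t := by positivity
  have k1 := lintegral_le_of_reaches A (isSCLoss_signLoss hμ hL hw hχ hχabs) hμ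
    (risk_signLoss_sub hμ hw hi hm) h1 ht0
  have k2 := lintegral_le_of_reaches A
    (isSCLoss_signLoss hμ hL hw hχ.neg (fun ξ => by simpa using hχabs ξ)) hμ
    (risk_signLoss_sub hμ hw hi.neg hm') h2 ht0
  have ho : Measurable (fun p : (E d × A.Mem) × A.Seed => A.output p.1) :=
    A.measurable_output.comp measurable_fst
  have hprod : ∀ θ : E d, t * (4 * (a ^ 2 * R ^ 2))
      ≤ (‖θ - (-(a * R) • w)‖ ^ 2 + t) * (‖θ - (-(-a * R) • w)‖ ^ 2 + t) := by
    intro θ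
    set x := ‖θ - (-(a * R) • w)‖
    set y := ‖θ - (-(-a * R) • w)‖
    have hxy : 2 * (|a| * |R|) ≤ x + y := by
      have e1 : ‖(2 * (a * R)) • w‖ ≤ x + y := by
        rw [show (2 * (a * R)) • w = (θ - (-(a * R) • w)) - (θ - (-(-a * R) • w)) by module]
        exact norm_sub_le _ _
      rwa [norm_smul, hw, mul_one, Real.norm_eq_abs, abs_mul, abs_mul, abs_two] at e1
    have e2 : 4 * (a ^ 2 * R ^ 2) ≤ (x + y) ^ 2 := by
      calc 4 * (a ^ 2 * R ^ 2) = (2 * (|a| * |R|)) ^ 2 := by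
            rw [mul_pow, mul_pow, sq_abs, sq_abs]; norm_num
        _ ≤ _ := by gcongr
    calc t * (4 * (a ^ 2 * R ^ 2)) ≤ t * (x + y) ^ 2 := by gcongr
      _ ≤ _ := by nlinarith [sq_nonneg (x * y - t)]
  have haff := affinity_stateLaw A hμ hL hw hχ hχ1 D θ₀ T
    (u := fun p => ENNReal.ofReal (‖A.output p.1 - (-(a * R) • w)‖ ^ 2 + t))
    (v := fun p => ENNReal.ofReal (‖A.output p.1 - (-(-a * R) • w)‖ ^ 2 + t))
    (by fun_prop) (by fun_prop) (c := ENNReal.ofReal (t * (4 * (a ^ 2 * R ^ 2))))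
    (fun p => by
      rw [← ENNReal.ofReal_mul (by positivity)]
      exact ENNReal.ofReal_le_ofReal (hprod _))
  have h4 : (4 : ℝ≥0∞) * ENNReal.ofReal ((1 - a ^ 2) / 4) = ENNReal.ofReal (1 - a ^ 2) := by
    rw [show (4 : ℝ≥0∞) = ENNReal.ofReal 4 by simp, ← ENNReal.ofReal_mul (by norm_num)]
    congr 1
    ring
  rw [hp, h4, ← ENNReal.ofReal_pow (by linarith), ← ENNReal.ofReal_mul hα0] at haff
  have hfin := haff.trans (mul_le_mul' k1 k2)
  rw [← ENNReal.ofReal_mul (by positivity), ENNReal.ofReal_le_ofReal_iff (by positivity)] at hfin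
  have hsq : (2 * t) ^ 2 ≤ (2 * e / μ + t) ^ 2 := by
    refine le_trans (le_of_eq ?_) (hfin.trans (le_of_eq (sq _).symm))
    rw [ht]
    ring
  have hlin : 2 * t ≤ 2 * e / μ + t := le_of_sq_le_sq hsq (by positivity)
  have hlin' : t ≤ 2 * e / μ := by linarith
  rw [le_div_iff₀ hμ] at hlin'
  calc L ^ 2 / (8 * μ) * (a ^ 2 * α) = t * μ / 2 := by
        rw [ht, hR]; field_simp; ring
    _ ≤ e := by linarith

theorem Algorithm.reaches_of_time_le (A : Algorithm d) {l : E d → E s → ℝ} {D : Measure (E s)}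
    {θ₀ θm : E d} {e : ℝ} {N : ℕ} (h : A.time l D θ₀ θm e ≤ N) : A.Reaches l D θ₀ θm e N := by
  by_contra hN
  have h1 : ((N + 1 : ℕ) : ℕ∞) ≤ A.time l D θ₀ θm e := by
    refine le_iInf₂ fun T hT => ?_
    have : N + 1 ≤ T := by
      by_contra! hlt
      exact hN (hT N (by omega))
    exact_mod_cast this
  have h2 := h1.trans h
  norm_cast at h2
  omega

theorem excess_ge_of_worstScratchTime_le (A : Algorithm d) (hd : 0 < d) (hμ : 0 < μ) (hL : 0 < L)
    {D : Measure (E s)} [IsProbabilityMeasure D] (hD : IsFlexible D) {e : ℝ} (he : 0 ≤ e) {N : ℕ}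
    (hN : A.worstScratchTime μ L D e ≤ N) {a : ℝ} (ha0 : 0 ≤ a) (ha1 : a ≤ 1) :
    L ^ 2 / (8 * μ) * (a ^ 2 * (1 - a ^ 2) ^ N) ≤ e := by
  classical
  obtain ⟨S, hS, hSp⟩ := hD ((1 + a) / 2) (by linarith) (by linarith)
  set w : E d := EuclideanSpace.single ⟨0, hd⟩ 1 with hwdef
  have hw : ‖w‖ = 1 := by simp [hwdef]
  set χ : E s → ℝ := fun ξ => if ξ ∈ S then 1 else -1 with hχdef
  have hχ : Measurable χ := Measurable.ite hS measurable_const measurable_const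
  have hχ1 : ∀ ξ, χ ξ = 1 ∨ χ ξ = -1 := fun ξ => by
    by_cases h : ξ ∈ S <;> simp [hχdef, h]
  have hχabs : ∀ ξ, |χ ξ| = 1 := fun ξ => by rcases hχ1 ξ with h | h <;> simp [h]
  have hi : Integrable χ D := Integrable.of_bound (C := 1) hχ.aestronglyMeasurable
    (Filter.Eventually.of_forall fun ξ => (hχabs ξ).le)
  have s1 : {ξ | χ ξ = 1} = S := by
    ext ξ
    by_cases h : ξ ∈ S <;> norm_num [hχdef, h]
  have s2 : {ξ | χ ξ = -1} = Sᶜ := by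
    ext ξ
    by_cases h : ξ ∈ S <;> norm_num [hχdef, h]
  have hSc : D Sᶜ = ENNReal.ofReal ((1 - a) / 2) := by
    rw [prob_compl_eq_one_sub hS, hSp, ← ENNReal.ofReal_one, ← ENNReal.ofReal_sub _ (by linarith)]
    congr 1
    ring
  have hm : ∫ ξ, χ ξ ∂D = a := by
    have e1 : χ = fun ξ => 2 * S.indicator 1 ξ - 1 := by
      ext ξ
      by_cases h : ξ ∈ S <;> norm_num [hχdef, h]
    have e2 : Integrable (S.indicator (1 : E s → ℝ)) D := (integrable_const (1 : ℝ)).indicator hS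
    simp only [e1]
    rw [integral_sub (e2.const_mul 2) (integrable_const _),
      integral_const_mul, integral_indicator_one hS]
    simp only [Measure.real, hSp, ENNReal.toReal_ofReal (show 0 ≤ (1 + a) / 2 by linarith)]
    simp
    ring
  have hm' : ∫ ξ, (-χ) ξ ∂D = -a := by
    simp only [Pi.neg_apply]
    rw [integral_neg, hm]
  have hp : D {ξ | χ ξ = 1} * D {ξ | χ ξ = -1} = ENNReal.ofReal ((1 - a ^ 2) / 4) := by
    rw [s1, s2, hSp, hSc, ← ENNReal.ofReal_mul (by linarith)]
    congr 1
    ring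
  have habs : |a| ≤ 1 := abs_le.2 ⟨by linarith, ha1⟩
  have hle : ∀ {l : E d → E s → ℝ} {θ : E d}, IsSCLoss μ L l → IsRiskMinimizer (L / (2 * μ)) l D θ →
      A.Reaches l D 0 θ e N := fun {l θ} hl hθ =>
    A.reaches_of_time_le <| le_trans
      (le_iSup₂_of_le l hl (le_iSup₂_of_le (f := fun θ _ => A.time l D 0 θ e) θ hθ le_rfl)) hN
  exact excess_ge_of_reaches A hμ hL hw hχ hχ1 0 (by nlinarith) he N hp hi hm
    (hle (isSCLoss_signLoss hμ hL hw hχ hχabs) (isRiskMinimizer_signLoss hμ hL hw hi habs hm))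
    (hle (isSCLoss_signLoss hμ hL hw hχ.neg (fun ξ => by simpa using hχabs ξ))
      (isRiskMinimizer_signLoss hμ hL hw hi.neg (by rwa [abs_neg]) hm'))

theorem le_of_scratchTime_le (hd : 0 < d) (hμ : 0 < μ) (hL : 0 < L)
    {D : Measure (E s)} [IsProbabilityMeasure D] (hD : IsFlexible D) {e : ℝ} (he : 0 < e)
    (he0 : e < L ^ 2 / (8 * μ)) {N : ℕ} (hN : scratchTime d μ L D e ≤ N) :
    N ≠ 0 ∧ L ^ 2 / (8 * μ) / (8 * e) ≤ N := by
  obtain ⟨A, hA⟩ : ∃ A : Algorithm d, A.worstScratchTime μ L D e ≤ N := by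
    by_contra! hlt
    have h1 : ((N + 1 : ℕ) : ℕ∞) ≤ scratchTime d μ L D e :=
      le_iInf fun A => by
        push_cast
        exact Order.add_one_le_of_lt (hlt A)
    have h2 := h1.trans hN
    norm_cast at h2
    omega
  have key := fun {a : ℝ} => excess_ge_of_worstScratchTime_le A hd hμ hL hD he.le hA (a := a)
  set e₀ := L ^ 2 / (8 * μ)
  have hN0 : N ≠ 0 := by
    rintro rfl
    have := key zero_le_one le_rfl
    simp only [pow_zero, one_pow, mul_one] at this
    linarith
  refine ⟨hN0, ?_⟩
  have hN1 : (1 : ℝ) ≤ N := by exact_mod_cast Nat.one_le_iff_ne_zero.2 hN0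
  -- The bias `a² = 1 / (2 (N + 1))` is barely detectable from `N` samples.
  set b : ℝ := 1 / (2 * (N + 1)) with hb
  have hb0 : 0 ≤ b := by positivity
  have hb1 : b ≤ 1 := by
    rw [hb, div_le_one (by positivity)]
    linarith
  have h1 := key (Real.sqrt_nonneg b) (Real.sqrt_le_one.2 hb1)
  rw [Real.sq_sqrt hb0] at h1
  have h2 := one_add_mul_le_pow (show (-2 : ℝ) ≤ -b by linarith) N
  have h3 : N * b ≤ 1 / 2 := by
    rw [hb, mul_one_div, div_le_div_iff₀ (by positivity) (by norm_num)]
    linarith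
  have h4 : (1 : ℝ) / 2 ≤ (1 - b) ^ N := by
    rw [sub_eq_add_neg]
    linarith
  have h5 : e₀ * (b * (1 / 2)) ≤ e := le_trans (by have : 0 < e₀ := he.trans he0; gcongr) h1
  rw [hb] at h5
  rw [div_le_iff₀ (by positivity)]
  have h6 : e₀ = e₀ * (1 / (2 * (N + 1)) * (1 / 2)) * (4 * (N + 1)) := by
    field_simp
    ring
  rw [h6]
  calc _ ≤ e * (4 * (N + 1)) := by gcongr
    _ ≤ _ := by nlinarith

end LowerBound

/-! ### Comparison of the times -/

section Comparison

variable {d s : ℕ} {μ L : ℝ}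

theorem scratchTime_lt_top (hμ : 0 < μ) (hL : 0 < L) (D : Measure (E s))
    [IsProbabilityMeasure D] {e : ℝ} (he : 0 < e) : scratchTime d μ L D e < ⊤ := by
  set x := (L / (2 * μ)) ^ 2 * L ^ 2 / e ^ 2 with hx
  refine lt_of_le_of_lt (iInf_le _ (noiseFineTune d (L / (2 * μ)) 0 (e / L ^ 2))) ?_
  refine lt_of_le_of_lt ?_ (ENat.natCast_lt_top (⌈x⌉₊ - 1))
  refine iSup₂_le fun l h => iSup₂_le fun θr hr => ?_
  refine time_noiseFineTune_le h hL hμ 0 he hr.integrable 0 hr.norm_le ?_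
  have := hr.norm_le
  rw [zero_sub, norm_neg, zero_pow two_ne_zero, mul_zero, add_zero, hx]
  gcongr

theorem ofReal_le_scratchTime (hd : 0 < d) (hμ : 0 < μ) (hL : 0 < L) {D : Measure (E s)}
    [IsProbabilityMeasure D] (hD : IsFlexible D) {e : ℝ} (he : 0 < e) (he0 : e < L ^ 2 / (8 * μ)) :
    ENNReal.ofReal (L ^ 2 / (8 * μ) / (8 * e)) ≤ (scratchTime d μ L D e : ℝ≥0∞) := by
  obtain ⟨N, hN⟩ := ENat.ne_top_iff_exists.1 (scratchTime_lt_top (d := d) hμ hL D he).ne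
  rw [← hN]
  have h1 := (le_of_scratchTime_le hd hμ hL hD he he0 hN.symm.le).2
  refine (ENNReal.ofReal_le_ofReal h1).trans ?_
  simp

theorem scratchTime_pos (hd : 0 < d) (hμ : 0 < μ) (hL : 0 < L) {D : Measure (E s)}
    [IsProbabilityMeasure D] (hD : IsFlexible D) {e : ℝ} (he : 0 < e) (he0 : e < L ^ 2 / (8 * μ)) :
    0 < scratchTime d μ L D e := by
  rw [pos_iff_ne_zero]
  intro h0
  exact (le_of_scratchTime_le hd hμ hL hD he he0 (N := 0) (by simp [h0])).1 rfl

theorem worstUnlearnTime_noiseFineTune_le (hμ : 0 < μ) (hL : 0 < L) {rf : ℝ}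
    (h0 : 0 ≤ rf) (h1 : rf < 1) {c : ℝ} (κ : ℝ) (Dr Df : Measure (E s)) [IsProbabilityMeasure Dr]
    [IsProbabilityMeasure Df] {e : ℝ} (he : 0 < e) :
    ((noiseFineTune d (L / (2 * μ)) (c * κ * (rf / (1 - rf)) * (L / μ))
        (e / L ^ 2)).worstUnlearnTime μ L rf Dr Df e : ℝ≥0∞)
      ≤ ENNReal.ofReal ((16 + c ^ 2) * (rf / (1 - rf)) ^ 2 * (1 + d * κ ^ 2) * (L / μ) ^ 2
          * L ^ 2 / e ^ 2) := by
  set x := (16 + c ^ 2) * (rf / (1 - rf)) ^ 2 * (1 + d * κ ^ 2) * (L / μ) ^ 2 * L ^ 2 / e ^ 2 with hx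
  have hx0 : 0 ≤ x := by positivity
  have h1' : 0 < 1 - rf := by linarith
  have hle : (noiseFineTune d (L / (2 * μ)) (c * κ * (rf / (1 - rf)) * (L / μ))
      (e / L ^ 2)).worstUnlearnTime μ L rf Dr Df e ≤ ((⌈x⌉₊ - 1 : ℕ) : ℕ∞) := by
    refine iSup₂_le fun l h => iSup₂_le fun θr hr => iSup₂_le fun θs hs => ?_
    refine time_noiseFineTune_le h hL hμ _ he hr.integrable θs hr.norm_le ?_
    -- The retained distribution is its own mixture, so the stability bound applies to `θr`.
    have hr' : IsRiskMinimizer (L / (2 * μ)) l (mixture rf Dr Dr) θr := by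
      rwa [mixture_self h0 h1]
    have hdist : ‖θs - θr‖ ≤ 4 * (rf / (1 - rf)) * (L / μ) := by
      refine (norm_minimizer_sub_le h hμ hL h0 h1 hs hr').trans ?_
      rw [mul_div_assoc]
      gcongr
      rw [le_div_iff₀ h1']
      nlinarith
    rw [hx]
    gcongr
    calc ‖θs - θr‖ ^ 2 + d * (c * κ * (rf / (1 - rf)) * (L / μ)) ^ 2
        ≤ (4 * (rf / (1 - rf)) * (L / μ)) ^ 2 + d * (c * κ * (rf / (1 - rf)) * (L / μ)) ^ 2 := by
          gcongr
      _ = (16 + c ^ 2 * (d * κ ^ 2)) * ((rf / (1 - rf)) ^ 2 * (L / μ) ^ 2) := by ring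
      _ ≤ ((16 + c ^ 2) * (1 + d * κ ^ 2)) * ((rf / (1 - rf)) ^ 2 * (L / μ) ^ 2) := by
          refine mul_le_mul_of_nonneg_right ?_ (by positivity)
          have : 0 ≤ 16 * (d * κ ^ 2) + c ^ 2 := by positivity
          linarith
      _ = _ := by ring
  refine (ENat.toENNReal_le.2 hle).trans ?_
  rw [ENat.toENNReal_coe, ← ENNReal.ofReal_natCast]
  refine ENNReal.ofReal_le_ofReal ?_
  rcases Nat.eq_zero_or_pos ⌈x⌉₊ with hz | hz
  · rw [hz]; simpa using hx0
  · rw [Nat.cast_pred hz]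
    linarith [Nat.ceil_lt_add_one hx0]

end Comparison

end Unlearning

open MeasureTheory Unlearning in
theorem theorem3 (εmax : ℝ) (hεmax : 0 < εmax) :
    ∃ c C : ℝ, 0 < c ∧ 0 < C ∧
      ∀ (d s : ℕ) (_ : 0 < d) (μ L : ℝ) (_ : 0 < μ) (_ : 0 < L)
        (rf : ℝ) (_ : 0 ≤ rf) (_ : rf < 1)
        (ε δ : ℝ) (_ : 0 < ε) (_ : ε ≤ εmax) (_ : 0 < δ) (_ : δ < 1)
        (Dr Df : Measure (E s)) (_ : IsProbabilityMeasure Dr) (_ : IsProbabilityMeasure Df)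
        (_ : IsFlexible Dr)
        (e₀ : ℝ) (_ : e₀ = L ^ 2 / (8 * μ)) (e : ℝ) (_ : 0 < e) (_ : e < e₀),
        0 < scratchTime d μ L Dr e ∧ scratchTime d μ L Dr e < ⊤ ∧
        (unlearnTime d μ L rf ε δ Dr Df e : ENNReal) / (scratchTime d μ L Dr e : ENNReal)
          ≤ ENNReal.ofReal
              (C * ((rf / (1 - rf)) ^ 2 * (1 + d * kappa ε δ ^ 2) * (e₀ / e))) ∧
        ∃ U : Algorithm d,
          U = noiseFineTune d (L / (2 * μ)) (c * kappa ε δ * (rf / (1 - rf)) * (L / μ)) (e / L ^ 2) ∧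
          U.IsUnlearning s μ L rf ε δ ∧
          (U.worstUnlearnTime μ L rf Dr Df e : ENNReal) / (scratchTime d μ L Dr e : ENNReal)
            ≤ ENNReal.ofReal
                (C * ((rf / (1 - rf)) ^ 2 * (1 + d * kappa ε δ ^ 2) * (e₀ / e))) := by
  refine ⟨8 + 8 * εmax, 512 * (16 + (8 + 8 * εmax) ^ 2), by positivity, by positivity, ?_⟩
  intro d s hd μ L hμ hL rf h0 h1 ε δ hε hεm hδ hδ1 Dr Df _ _ hflex e₀ he₀ e he hlt
  subst he₀
  set c := 8 + 8 * εmax with hc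
  set U := noiseFineTune d (L / (2 * μ)) (c * kappa ε δ * (rf / (1 - rf)) * (L / μ)) (e / L ^ 2)
    with hU
  have hunl : U.IsUnlearning s μ L rf ε δ :=
    isUnlearning_noiseFineTune hμ hL h0 h1 hε hδ hδ1 (by linarith) _
  have hratio : (U.worstUnlearnTime μ L rf Dr Df e : ENNReal) / (scratchTime d μ L Dr e : ENNReal)
      ≤ ENNReal.ofReal (512 * (16 + c ^ 2) *
          ((rf / (1 - rf)) ^ 2 * (1 + d * kappa ε δ ^ 2) * (L ^ 2 / (8 * μ) / e))) := by
    refine ENNReal.div_le_of_le_mul ?_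
    refine (worstUnlearnTime_noiseFineTune_le hμ hL h0 h1 (kappa ε δ) Dr Df he).trans ?_
    refine le_trans ?_ (mul_le_mul' le_rfl (ofReal_le_scratchTime hd hμ hL hflex he hlt))
    rw [← ENNReal.ofReal_mul (by positivity)]
    refine ENNReal.ofReal_le_ofReal (le_of_eq ?_)
    -- `L⁴ / μ² = 64 e₀²`, and the retraining time is at least `e₀ / (8 e)`.
    have h1' : 1 - rf ≠ 0 := by linarith
    field_simp
    ring
  refine ⟨scratchTime_pos hd hμ hL hflex he hlt, scratchTime_lt_top hμ hL Dr he, ?_, U, rfl, hunl,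
    hratio⟩
  refine le_trans (ENNReal.div_le_div_right (ENat.toENNReal_le.2 (iInf₂_le U hunl)) _) hratio
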